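/- **Setting.** Let $q\ge 1$ and let $\mathcal T$ be a homogeneous tree of order $q$ (an acyclic, connected, undirected graph in which every node belongs to exactly $q+1$ edges). Fix a boundary point $\infty_{\mathcal T}$ of $\mathcal T$, i.e. an equivalence class of infinite paths without backtracking, two paths being equivalent if they coincide up to finitely many edges. For every node $t$ there is a unique path in the class $\infty_{\mathcal T}$ that begins at $t$; let $s\wedge t$ be the node at which the paths that begin at $s$ and at $t$ first meet. Write $s\preceq t$ if $\operatorname{dist}(s,s\wedge t)\le\operatorname{dist}(t,s\wedge t)$ and $s\asymp t$ if the two distances are equal. Fix maps $\alpha_1,\dots,\alpha_q:\mathcal T\to\mathcal T$, written $t\mapsto t\alpha_j$, with $\{t\alpha_1,\dots,t\alpha_q\}=\{s: t\preceq s,\ \operatorname{dist}(t,s)=1\}$ for every node $t$, and let $\alpha_j$ also denote the operator $(\alpha_jf)(t)=f(t\alpha_j)$ on $\ell_2(\mathcal T)$. A word $w=\alpha_{i_1}\cdots\alpha_{i_n}$ of length $|w|=n$ acts by $t\mapsto tw=t\alpha_{i_1}\cdots\alpha_{i_n}$ and by $(wf)(t)=f(tw)$. Let $(\chi_t)$ be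 the standard basis of $\ell_2(\mathcal T)$. A bounded operator $S$ on $\ell_2(\mathcal T)$ is *causal* if, for every node $s$ and every $f\in\ell_2(\mathcal T)$ with $f(t)=0$ for all $t\preceq s$, one has $(Sf)(t)=0$ for all $t\preceq s$. Let $\mathbf H(\mathcal T)$ be the algebra of causal operators and $\mathcal C=\{S: S,S^*\in\mathbf H(\mathcal T)\}$. Let $\mathbf H_2(\mathcal T)$ be the Hilbert space of those $F\in\mathbf H(\mathcal T)$ that are Hilbert–Schmidt, with $\langle F,G\rangle_2=\operatorname{trace}(G^*F)$, and let $\mathcal C_2=\mathcal C\cap\mathbf H_2(\mathcal T)$. For $c=(c_1,\dots,c_q)\in\mathcal C^q$ put $c\alpha=\sum_jc_j\alpha_j$, and let $\mathbb B(\mathcal T)=\{c\in\mathcal C^q:\lim_{n\to\infty}\|(c\alpha)^n\|^{1/n}<1\}$. For $S\in\mathbf H(\mathcal T)$ and $c\in\mathbb B(\mathcal T)$ the point evaluation is $$S^\wedge(c)=\sum_{n=0}^\infty(c\alpha)^n\Big(\sum_{|w|=n}w^*S_{[w]}\Big)$$ (absolutely convergent in the operator norm), where $S_{[w]}\in\mathcal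 C$ is given by $(S_{[w]}\chi_t)(s)=(S\chi_t)(sw)$ if $t\asymp s$ and $(S_{[w]}\chi_t)(s)=0$ otherwise. A *Schur multiplier* is an $S\in\mathbf H(\mathcal T)$ with $\|S\|\le1$. For such $S$ let $M_SF=SF$ on $\mathbf H_2(\mathcal T)$, $\mathcal B_S=I-M_SM_S^*$, and let $\pi_S$ be the orthogonal projection of $\mathbf H_2(\mathcal T)$ onto $\ker\mathcal B_S$. The de Branges–Rovnyak space of $S$ is $\mathbf H(S)=\sqrt{\mathcal B_S}\,\mathbf H_2(\mathcal T)$ with the norm $\|\sqrt{\mathcal B_S}F\|_{\mathbf H(S)}=\|(I-\pi_S)F\|_2$ and the corresponding inner product. For $c\in\mathbb B(\mathcal T)$ put $$K_S^c=(I-S\,S^\wedge(c)^*)\Big(I-\sum_j\alpha_j^*c_j^*\Big)^{-1}.$$ **Proposition 6.4.** Let $S$ be a Schur multiplier. Then: 1. $\mathbf H(S)$ is a right $\mathcal C$-invariant Hilbert space: it is complete, and for all $F,G\in\mathbf H(S)$ and $c\in\mathcal C$, $$Fc\in\mathbf H(S),\qquad\|Fc\|_{\mathbf H(S)}\le\|F\|_{\mathbf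 H(S)}\|c\|,\qquad\langle Fc,G\rangle_{\mathbf H(S)}=\langle F,Gc^*\rangle_{\mathbf H(S)}.$$ 2. For all $k\in\mathcal C_2$ and $c\in\mathbb B(\mathcal T)$ one has $K_S^ck\in\mathbf H(S)$, and for every $F\in\mathbf H(S)$ one has $F^\wedge(c)\in\mathcal C_2$ and $$\langle F,K_S^ck\rangle_{\mathbf H(S)}=\langle F^\wedge(c),k\rangle_2 .$$ 3. The linear span of $\{K_S^ck: k\in\mathcal C_2,\ c\in\mathbb B(\mathcal T)\}$ is dense in $\mathbf H(S)$. -/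

import Mathlib

/-- An infinite path in the graph `G`: consecutive nodes are joined by an edge and consecutive
edges are distinct. -/
structure GraphRay {V : Type*} (G : SimpleGraph V) where
  node : ℕ → V
  adj : ∀ k, G.Adj (node k) (node (k + 1))
  noBacktrack : ∀ k, node (k + 2) ≠ node k

namespace GraphRay

variable {V : Type*} {G : SimpleGraph V}

@[ext] theorem ext {r r' : GraphRay G} (h : ∀ k, r.node k = r'.node k) : r = r' := by
  cases r; cases r'; congr; exact funext h

/-- From index `m` on, the first path coincides with the second path from index `n` on. -/
def Coincide (r r' : GraphRay G) (m n : ℕ) : Prop :=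
  ∀ k, r.node (m + k) = r'.node (n + k)

/-- Two paths are equivalent if they coincide modulo a finite number of edges. -/
instance setoid (G : SimpleGraph V) : Setoid (GraphRay G) where
  r r₁ r₂ := ∃ m n, Coincide r₁ r₂ m n
  iseqv :=
    { refl := fun _ => ⟨0, 0, fun _ => rfl⟩
      symm := fun ⟨m, n, h⟩ => ⟨n, m, fun k => (h k).symm⟩
      trans := fun {r₁ r₂ r₃} ⟨m, n, h⟩ ⟨m', n', h'⟩ => ⟨m + m', n' + n, fun k => by
        have h1 := h (m' + k)
        have h2 := h' (n + k)
        rw [← Nat.add_assoc] at h1 h2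
        rw [h1, Nat.add_assoc, Nat.add_left_comm, ← Nat.add_assoc, h2]⟩ }

end GraphRay

/-- The boundary points of a tree: equivalence classes of infinite paths. -/
abbrev TreeBoundary {V : Type*} (G : SimpleGraph V) : Type _ := Quotient (GraphRay.setoid G)

/-- `u = s ∧ t` relative to the boundary point `b`: for the representatives of `b` that begin at
`s` and at `t`, `u` is the node at which they begin to coincide, i.e. the indices `m`, `n` with
`s_{m+k} = t_{n+k}` for all `k` are chosen minimal and `u = s_m = t_n`. -/
def IsMeet {V : Type*} {G : SimpleGraph V} (b : TreeBoundary G) (s t u : V) : Prop :=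
  ∃ r r' : GraphRay G, ⟦r⟧ = b ∧ ⟦r'⟧ = b ∧ r.node 0 = s ∧ r'.node 0 = t ∧
    ∃ m n, r.Coincide r' m n ∧ (∀ m' n', r.Coincide r' m' n' → m ≤ m' ∧ n ≤ n') ∧ r.node m = u

/-- `s ⪯ t` if `dist(s, s ∧ t) ≤ dist(t, s ∧ t)`. -/
def HoroLE {V : Type*} {G : SimpleGraph V} (b : TreeBoundary G) (s t : V) : Prop :=
  ∃ u, IsMeet b s t u ∧ G.dist s u ≤ G.dist t u

/-- `s ≍ t` if `dist(s, s ∧ t) = dist(t, s ∧ t)`; the classes are the horocycles. -/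
def HoroEq {V : Type*} {G : SimpleGraph V} (b : TreeBoundary G) (s t : V) : Prop :=
  ∃ u, IsMeet b s t u ∧ G.dist s u = G.dist t u

section TreeFacts

variable {V : Type*} {G : SimpleGraph V}

theorem tree_closer_unique (hG : G.IsTree) {u v w w' : V} (hw : G.Adj v w) (hw' : G.Adj v w')
    (h : G.dist u v = G.dist u w + 1) (h' : G.dist u v = G.dist u w' + 1) : w = w' := by
  have key : ∀ x, G.Adj v x → G.dist u v = G.dist u x + 1 →
      ∀ p : G.Walk u v, p.IsPath → x = p.penultimate := by
    intro x hx hd p hp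
    obtain ⟨p', hp'⟩ := (hG.connected u x).exists_walk_length_eq_dist
    have hq : (p'.concat hx.symm).length = G.dist u v := by simp [hp', hd]
    have hq' := SimpleGraph.Walk.isPath_of_length_eq_dist _ hq
    have := (hG.existsUnique_path u v).unique hp hq'
    rw [this]; simp
  obtain ⟨p, hp, -⟩ := hG.existsUnique_path u v
  rw [key w hw h p hp, key w' hw' h' p hp]

namespace GraphRay

theorem dist_node (hG : G.IsTree) (r : GraphRay G) (n : ℕ) :
    G.dist (r.node 0) (r.node n) = n := by
  have : G.dist (r.node 0) (r.node n) = n ∧ G.dist (r.node 0) (r.node (n + 1)) = n + 1 := by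
    induction n with
    | zero => exact ⟨by simp, by simpa using (r.adj 0)⟩
    | succ n ih =>
      refine ⟨ih.2, ?_⟩
      rcases hG.dist_eq_dist_add_one_of_adj (r.node 0) (r.adj (n + 1)) with h | h
      · exact absurd (tree_closer_unique hG (r.adj (n + 1)) (r.adj n).symm h
          (by rw [ih.1, ih.2])) (r.noBacktrack n)
      · rw [h, ih.2]
  exact this.1

/-- The path without its first edge. -/
def tail (r : GraphRay G) : GraphRay G :=
  ⟨fun k => r.node (k + 1), fun k => r.adj (k + 1), fun k => r.noBacktrack (k + 1)⟩

/-- The path with one more node in front. -/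
def cons (r : GraphRay G) (v : V) (h : G.Adj v (r.node 0)) (h' : r.node 1 ≠ v) : GraphRay G where
  node := fun k => Nat.casesOn k v r.node
  adj := fun k => by cases k with
    | zero => exact h
    | succ k => exact r.adj k
  noBacktrack := fun k => by cases k with
    | zero => exact h'
    | succ k => exact r.noBacktrack k

/-- The path that begins at the `n`-th node. -/
def drop (r : GraphRay G) (n : ℕ) : GraphRay G :=
  ⟨fun k => r.node (n + k), fun k => r.adj (n + k), fun k => r.noBacktrack (n + k)⟩

theorem dist_node' (hG : G.IsTree) (r : GraphRay G) (m n : ℕ) :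
    G.dist (r.node m) (r.node (m + n)) = n := (r.drop m).dist_node hG n

theorem node_injective (hG : G.IsTree) (r : GraphRay G) : Function.Injective r.node := by
  intro m n h
  have h1 := r.dist_node hG m
  rw [h, r.dist_node hG n] at h1
  exact h1.symm

theorem eq_of_equiv (hG : G.IsTree) {r r' : GraphRay G} (h : r ≈ r')
    (h0 : r.node 0 = r'.node 0) : r = r' := by
  obtain ⟨m, n, hc⟩ := h
  have hmn : m = n := by
    rw [← r.dist_node hG m, ← r'.dist_node hG n, h0]
    congr 1
    exact hc 0
  subst hmn
  have key : ∀ j ≤ m, r.node (m - j) = r'.node (m - j) := by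
    intro j
    induction j with
    | zero => intro _; exact hc 0
    | succ j ih =>
      intro hj
      have ih := ih (by omega)
      have e : m - j = (m - (j + 1)) + 1 := by omega
      rw [e] at ih
      refine tree_closer_unique hG (u := r.node 0) (r.adj _).symm
        (ih ▸ (r'.adj (m - (j + 1))).symm) ?_ ?_
      · rw [r.dist_node hG, r.dist_node hG]
      · rw [r.dist_node hG, h0, r'.dist_node hG]
  ext k
  rcases le_total k m with hk | hk
  · have := key (m - k) (by omega)
    rwa [Nat.sub_sub_self hk] at this
  · have := hc (k - m)
    rwa [Nat.add_sub_cancel' hk] at this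

theorem tail_equiv (r : GraphRay G) : r.tail ≈ r :=
  ⟨0, 1, fun k => by simp [tail, Nat.add_comm]⟩

theorem cons_equiv (r : GraphRay G) (v : V) (h : G.Adj v (r.node 0)) (h' : r.node 1 ≠ v) :
    r.cons v h h' ≈ r :=
  ⟨1, 0, fun k => by rw [Nat.add_comm 1 k, Nat.zero_add]; rfl⟩

end GraphRay

theorem exists_ray (hG : G.IsTree) (b : TreeBoundary G) (v : V) :
    ∃ r : GraphRay G, ⟦r⟧ = b ∧ r.node 0 = v := by
  obtain ⟨r, rfl⟩ := Quotient.exists_rep b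
  obtain ⟨p⟩ := hG.connected (r.node 0) v
  suffices h : ∀ (u w : V) (p : G.Walk u w), ∀ r₁ : GraphRay G, r₁.node 0 = u → r₁ ≈ r →
      ∃ r₂ : GraphRay G, r₂ ≈ r ∧ r₂.node 0 = w by
    obtain ⟨r₂, h1, h2⟩ := h _ _ p r rfl (Setoid.refl r)
    exact ⟨r₂, Quotient.sound h1, h2⟩
  intro u w p
  induction p with
  | nil => intro r₁ h1 h2; exact ⟨r₁, h2, h1⟩
  | @cons u x w hux p ih =>
    intro r₁ h1 h2
    by_cases hx : r₁.node 1 = x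
    · exact ih r₁.tail hx (Setoid.trans r₁.tail_equiv h2)
    · exact ih (r₁.cons x (h1 ▸ hux.symm) hx) rfl (Setoid.trans (r₁.cons_equiv _ _ _) h2)

theorem coincide_diff (hG : G.IsTree) {r r' : GraphRay G} {m n m' n' : ℕ}
    (h : r.Coincide r' m n) (h' : r.Coincide r' m' n') : m + n' = m' + n := by
  have h1 := h m'
  have h2 := h' m
  rw [Nat.add_comm m' m, h1] at h2
  have := r'.node_injective hG h2
  omega

theorem exists_isMeet (hG : G.IsTree) {b : TreeBoundary G} {r r' : GraphRay G} (hr : ⟦r⟧ = b)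
    (hr' : ⟦r'⟧ = b) {m n : ℕ} (h : r.Coincide r' m n) :
    ∃ u, IsMeet b (r.node 0) (r'.node 0) u ∧
      (G.dist (r.node 0) u : ℤ) - G.dist (r'.node 0) u = m - n := by
  classical
  have hex : ∃ m n, r.Coincide r' m n := ⟨m, n, h⟩
  obtain ⟨n₀, h₀⟩ := Nat.find_spec hex
  refine ⟨r.node (Nat.find hex), ⟨r, r', hr, hr', rfl, rfl, Nat.find hex, n₀, h₀, ?_, rfl⟩, ?_⟩
  · intro m' n' h'
    have h1 : Nat.find hex ≤ m' := Nat.find_min' hex ⟨n', h'⟩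
    have h2 := coincide_diff hG h₀ h'
    exact ⟨h1, by omega⟩
  · have h1 : r.node (Nat.find hex) = r'.node n₀ := h₀ 0
    have h2 := coincide_diff hG h₀ h
    have h3 : G.dist (r'.node 0) (r.node (Nat.find hex)) = n₀ := by
      rw [h1]; exact r'.dist_node hG _
    rw [r.dist_node hG, h3]
    omega

theorem isMeet_dist (hG : G.IsTree) {b : TreeBoundary G} {r r' : GraphRay G} (hr : ⟦r⟧ = b)
    (hr' : ⟦r'⟧ = b) {m n : ℕ} (h : r.Coincide r' m n) {u : V}
    (hu : IsMeet b (r.node 0) (r'.node 0) u) :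
      (G.dist (r.node 0) u : ℤ) - G.dist (r'.node 0) u = m - n := by
  obtain ⟨r₁, r₁', h1, h1', h2, h2', m', n', hc, -, rfl⟩ := hu
  obtain rfl := GraphRay.eq_of_equiv hG (Quotient.exact (h1.trans hr.symm)) h2
  obtain rfl := GraphRay.eq_of_equiv hG (Quotient.exact (h1'.trans hr'.symm)) h2'
  have h1 : r₁.node m' = r₁'.node n' := hc 0
  have h3 : G.dist (r₁'.node 0) (r₁.node m') = n' := by
    rw [h1]; exact r₁'.dist_node hG _
  have := coincide_diff hG hc h
  rw [r₁.dist_node hG, h3]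
  omega

theorem horoLE_iff (hG : G.IsTree) {b : TreeBoundary G} {r r' : GraphRay G} (hr : ⟦r⟧ = b)
    (hr' : ⟦r'⟧ = b) {m n : ℕ} (h : r.Coincide r' m n) :
    HoroLE b (r.node 0) (r'.node 0) ↔ m ≤ n := by
  constructor
  · rintro ⟨u, hu, hle⟩
    have := isMeet_dist hG hr hr' h hu
    omega
  · intro hle
    obtain ⟨u, hu, hd⟩ := exists_isMeet hG hr hr' h
    exact ⟨u, hu, by omega⟩

theorem horoEq_iff (hG : G.IsTree) {b : TreeBoundary G} {r r' : GraphRay G} (hr : ⟦r⟧ = b)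
    (hr' : ⟦r'⟧ = b) {m n : ℕ} (h : r.Coincide r' m n) :
    HoroEq b (r.node 0) (r'.node 0) ↔ m = n := by
  constructor
  · rintro ⟨u, hu, hle⟩
    have := isMeet_dist hG hr hr' h hu
    omega
  · intro hle
    obtain ⟨u, hu, hd⟩ := exists_isMeet hG hr hr' h
    exact ⟨u, hu, by omega⟩

theorem horoEq_iff_eventually (hG : G.IsTree) {b : TreeBoundary G} {r r' : GraphRay G}
    (hr : ⟦r⟧ = b) (hr' : ⟦r'⟧ = b) :
    HoroEq b (r.node 0) (r'.node 0) ↔ ∃ m, r.Coincide r' m m := by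
  constructor
  · intro h
    obtain ⟨m, n, hc⟩ := Quotient.exact (hr.trans hr'.symm)
    obtain rfl := (horoEq_iff hG hr hr' hc).1 h
    exact ⟨m, hc⟩
  · rintro ⟨m, hc⟩
    exact (horoEq_iff hG hr hr' hc).2 rfl

theorem horoEq_equivalence (hG : G.IsTree) (b : TreeBoundary G) : Equivalence (HoroEq b) where
  refl s := by
    obtain ⟨r, hr, rfl⟩ := exists_ray hG b s
    exact (horoEq_iff_eventually hG hr hr).2 ⟨0, fun _ => rfl⟩
  symm {s t} h := by
    obtain ⟨r, hr, rfl⟩ := exists_ray hG b s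
    obtain ⟨r', hr', rfl⟩ := exists_ray hG b t
    obtain ⟨m, hc⟩ := (horoEq_iff_eventually hG hr hr').1 h
    exact (horoEq_iff_eventually hG hr' hr).2 ⟨m, fun k => (hc k).symm⟩
  trans {s t u} h h' := by
    obtain ⟨r, hr, rfl⟩ := exists_ray hG b s
    obtain ⟨r', hr', rfl⟩ := exists_ray hG b t
    obtain ⟨r'', hr'', rfl⟩ := exists_ray hG b u
    obtain ⟨m, hc⟩ := (horoEq_iff_eventually hG hr hr').1 h
    obtain ⟨m', hc'⟩ := (horoEq_iff_eventually hG hr' hr'').1 h'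
    refine (horoEq_iff_eventually hG hr hr'').2 ⟨m + m', fun k => ?_⟩
    rw [Nat.add_assoc, hc, Nat.add_left_comm, hc', Nat.add_left_comm]

/-- The predecessor of a node is the second node of its path towards the boundary point. -/
theorem child_iff (hG : G.IsTree) {b : TreeBoundary G} {r : GraphRay G} (hr : ⟦r⟧ = b) (t : V) :
    HoroLE b t (r.node 0) ∧ G.dist t (r.node 0) = 1 ↔ r.node 1 = t := by
  constructor
  · rintro ⟨hle, hd⟩
    have hadj : G.Adj t (r.node 0) := SimpleGraph.dist_eq_one_iff_adj.1 hd
    obtain ⟨r', hr', rfl⟩ := exists_ray hG b t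
    by_cases h1 : r'.node 1 = r.node 0
    · have e : r'.tail = r := GraphRay.eq_of_equiv hG
        (Setoid.trans r'.tail_equiv (Quotient.exact (hr'.trans hr.symm))) h1
      have hc : r'.Coincide r 1 0 := fun k => by
        rw [← e]; simp [GraphRay.tail, Nat.add_comm]
      have := (horoLE_iff hG hr' hr hc).1 hle
      omega
    · have e : r'.cons _ hadj.symm h1 = r := GraphRay.eq_of_equiv hG
        (Setoid.trans (r'.cons_equiv _ _ _) (Quotient.exact (hr'.trans hr.symm))) rfl
      rw [← e]; rfl
  · rintro rfl
    refine ⟨?_, by simpa using (r.adj 0).symm⟩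
    have hr' : ⟦r.tail⟧ = b := (Quotient.sound r.tail_equiv).trans hr
    exact (horoLE_iff hG hr' hr (m := 0) (n := 1)
      (fun k => by simp [GraphRay.tail, Nat.add_comm])).2 (by omega)

end TreeFacts

open Filter Topology
open scoped NNReal ENNReal

/-- The Hilbert space `ℓ₂(𝒯)` of square-summable functions on the set of nodes. -/
abbrev Ell2 (V : Type*) : Type _ := lp (fun _ : V => ℂ) 2

/-- The C*-algebra `𝐗(𝒯)` of bounded operators on `ℓ₂(𝒯)`. -/
abbrev BddOp (V : Type*) : Type _ := Ell2 V →L[ℂ] Ell2 V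

open Classical in
/-- The element `χ_t` of the standard basis of `ℓ₂(𝒯)`. -/
noncomputable def chi {V : Type*} (t : V) : Ell2 V := lp.single 2 t 1

section Ell2Facts

variable {V : Type*}

open Classical in
theorem chi_apply (t s : V) : (chi t : Ell2 V) s = if s = t then 1 else 0 := by
  rw [chi, lp.single_apply, Pi.single_apply]

theorem enorm_sq_eq_tsum {ι : Type*} {E : ι → Type*} [∀ i, NormedAddCommGroup (E i)]
    (f : lp E 2) : ‖f‖ₑ ^ 2 = ∑' t, ‖f t‖ₑ ^ 2 := by
  have h := lp.norm_rpow_eq_tsum (p := 2) (by norm_num) f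
  have hs := (lp.memℓp f).summable (by norm_num)
  simp only [ENNReal.toReal_ofNat, Real.rpow_ofNat] at h hs
  have : ENNReal.ofReal (‖f‖ ^ 2) = ENNReal.ofReal (∑' i, ‖f i‖ ^ 2) := by rw [h]
  rw [ENNReal.ofReal_tsum_of_nonneg (fun _ => by positivity) hs,
    ENNReal.ofReal_pow (norm_nonneg _), ofReal_norm] at this
  rw [this]
  congr 1; ext t
  rw [ENNReal.ofReal_pow (norm_nonneg _), ofReal_norm]

theorem memℓp_two_of_tsum {ι : Type*} {E : ι → Type*} [∀ i, NormedAddCommGroup (E i)]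
    (g : ∀ i, E i) (h : ∑' t, ‖g t‖ₑ ^ 2 ≠ ⊤) : Memℓp g 2 := by
  apply memℓp_gen
  have := ENNReal.summable_toReal h
  simpa using this

theorem norm_le_of_tsum {f g : Ell2 V} {C : ℝ≥0}
    (h : ∑' s, ‖g s‖ₑ ^ 2 ≤ ((C : ℝ≥0∞) * ‖f‖ₑ) ^ 2) : ‖g‖ ≤ C * ‖f‖ := by
  rw [← enorm_sq_eq_tsum] at h
  have h2 := (ENNReal.pow_le_pow_left_iff (two_ne_zero)).1 h
  have h3 := ENNReal.toReal_mono (by finiteness) h2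
  simpa using h3

/-- A linear map from `ℓ₂(𝒯)` to functions, bounded in the `ℓ₂`-norm, as a bounded operator. -/
noncomputable def opOfBound (φ : Ell2 V →ₗ[ℂ] (V → ℂ)) (C : ℝ≥0)
    (h : ∀ f : Ell2 V, ∑' s, ‖φ f s‖ₑ ^ 2 ≤ ((C : ℝ≥0∞) * ‖f‖ₑ) ^ 2) : BddOp V :=
  LinearMap.mkContinuous
    { toFun := fun f => ⟨φ f, memℓp_two_of_tsum _
        (ne_top_of_le_ne_top (by finiteness) (h f))⟩
      map_add' := fun f g => by ext s; exact congrFun (φ.map_add f g) s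
      map_smul' := fun c f => by ext s; exact congrFun (φ.map_smul c f) s }
    C (fun f => norm_le_of_tsum (h f))

@[simp] theorem opOfBound_apply (φ : Ell2 V →ₗ[ℂ] (V → ℂ)) (C : ℝ≥0) (h) (f : Ell2 V) (s : V) :
    opOfBound φ C h f s = φ f s := rfl

theorem norm_opOfBound_le (φ : Ell2 V →ₗ[ℂ] (V → ℂ)) (C : ℝ≥0) (h) :
    ‖opOfBound φ C h‖ ≤ C := LinearMap.mkContinuous_norm_le _ C.2 _

theorem hasSum_chi (f : Ell2 V) : HasSum (fun t => f t • chi t) f := by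
  classical
  have := lp.hasSum_single (p := 2) (by norm_num) f
  convert this using 2 with t
  rw [chi, ← lp.single_smul, smul_eq_mul, mul_one]

theorem op_ext {A B : BddOp V} (h : ∀ t, A (chi t) = B (chi t)) : A = B := by
  ext1 f
  have h1 := (hasSum_chi f).mapL A
  have h2 := (hasSum_chi f).mapL B
  simp only [map_smul, h] at h1 h2
  exact h1.unique h2

open Classical in
/-- Keeping only the matrix entries of `S` whose row and column carry the same label yields a
bounded operator of no larger norm. -/
theorem exists_compression (S : BddOp V) {Q : Type*} (p p' : V → Q) :
    ∃ D : BddOp V, (∀ s t, D (chi t) s = if p t = p' s then S (chi t) s else 0) ∧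
      ‖D‖ ≤ ‖S‖ := by
  have hP (h : Q) : ∃ P : BddOp V, ∀ f t, P f t = if p t = h then f t else 0 := by
    refine ⟨opOfBound ⟨⟨fun f t => if p t = h then f t else 0, ?_⟩, ?_⟩ 1 ?_, fun f t => rfl⟩
    · intro f g; ext t; by_cases hh : p t = h <;> simp [hh]
    · intro c f; ext t; by_cases hh : p t = h <;> simp [hh]
    · intro f
      rw [ENNReal.coe_one, one_mul, enorm_sq_eq_tsum f]
      refine ENNReal.tsum_le_tsum fun t => ?_
      by_cases hh : p t = h <;> simp [hh]
  choose P hP using hP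
  have hsum (f : Ell2 V) : ∑' h, ‖P h f‖ₑ ^ 2 = ‖f‖ₑ ^ 2 := by
    simp_rw [enorm_sq_eq_tsum, hP]
    rw [ENNReal.tsum_comm]
    congr 1; ext t
    rw [tsum_eq_single (p t)]
    · simp
    · intro h hh; simp [hh.symm]
  refine ⟨opOfBound ⟨⟨fun f s => S (P (p' s) f) s, ?_⟩, ?_⟩ ‖S‖₊ ?_, ?_, ?_⟩
  · intro f g; ext s; simp
  · intro c f; ext s; simp
  · intro f
    calc ∑' s, ‖S (P (p' s) f) s‖ₑ ^ 2
        ≤ ∑' s, ∑' h, ‖S (P h f) s‖ₑ ^ 2 := by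
          refine ENNReal.tsum_le_tsum fun s => ?_
          exact ENNReal.le_tsum (f := fun h => ‖S (P h f) s‖ₑ ^ 2) (p' s)
      _ = ∑' h, ‖S (P h f)‖ₑ ^ 2 := by
          rw [ENNReal.tsum_comm]; simp_rw [enorm_sq_eq_tsum]
      _ ≤ ∑' h, (‖S‖₊ * ‖P h f‖ₑ) ^ 2 := by
          refine ENNReal.tsum_le_tsum fun h => ?_
          gcongr
          exact S.le_opENorm _
      _ = (‖S‖₊ * ‖f‖ₑ) ^ 2 := by
          simp_rw [mul_pow]; rw [ENNReal.tsum_mul_left, hsum]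
  · intro s t
    rw [opOfBound_apply]
    change S (P (p' s) (chi t)) s = _
    have : P (p' s) (chi t) = if p t = p' s then chi t else 0 := by
      ext u
      rw [hP, chi_apply]
      by_cases hu : u = t
      · subst hu; by_cases hh : p u = p' s <;> simp [hh, chi_apply]
      · by_cases hh : p t = p' s <;> simp [hh, hu, chi_apply]
    rw [this]
    split_ifs <;> simp
  · exact norm_opOfBound_le _ _ _

end Ell2Facts

/-- A homogeneous tree of order `q ≥ 1` (acyclic, connected, every node belonging to exactly
`q + 1` edges) with a distinguished boundary point and primitive shifts `t ↦ tα_j`. -/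
structure HomogeneousTree (q : ℕ) (V : Type*) where
  graph : SimpleGraph V
  isTree : graph.IsTree
  one_le : 1 ≤ q
  degree : ∀ t, (graph.neighborSet t).ncard = q + 1
  /-- the distinguished boundary point `∞_𝒯` -/
  infty : TreeBoundary graph
  /-- `shift j t` is the node `tα_j` -/
  shift : Fin q → V → V
  range_shift : ∀ t, Set.range (fun j => shift j t) =
    {s | HoroLE infty t s ∧ graph.dist t s = 1}

namespace HomogeneousTree

variable {q : ℕ} {V : Type*} (T : HomogeneousTree q V)

/-- The partial ordering `⪯` on the nodes. -/
def Precedes (s t : V) : Prop := HoroLE T.infty s t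

/-- The relation `≍` on the nodes. -/
def Asymp (s t : V) : Prop := HoroEq T.infty s t

/-- The right action `t ↦ tw` of the word `w = α_{i₁} ⋯ α_{iₙ}`. -/
def act (w : List (Fin q)) (t : V) : V := w.foldl (fun s j => T.shift j s) t

theorem shift_eq_iff (r : GraphRay T.graph) (hr : ⟦r⟧ = T.infty) (t : V) :
    (∃ j, T.shift j t = r.node 0) ↔ r.node 1 = t := by
  have h := Set.ext_iff.1 (T.range_shift t) (r.node 0)
  rw [← child_iff T.isTree hr t]
  exact h

theorem shift_injective_node {i j : Fin q} {s t : V} (h : T.shift i s = T.shift j t) :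
    s = t := by
  obtain ⟨r, hr, h0⟩ := exists_ray T.isTree T.infty (T.shift i s)
  rw [← (T.shift_eq_iff r hr s).1 ⟨i, h0.symm⟩, ← (T.shift_eq_iff r hr t).1 ⟨j, h ▸ h0.symm⟩]

theorem shift_injective_index (t : V) : Function.Injective (fun j => T.shift j t) := by
  obtain ⟨r, hr, rfl⟩ := exists_ray T.isTree T.infty t
  have hsub : T.graph.neighborSet (r.node 0) ⊆
      insert (r.node 1) (Set.range (fun j => T.shift j (r.node 0))) := by
    intro s hs
    rw [T.range_shift]
    by_cases h1 : r.node 1 = s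
    · exact Or.inl h1.symm
    · right
      have := (T.shift_eq_iff (r.cons s (T.graph.adj_symm hs) h1)
        ((Quotient.sound (r.cons_equiv _ _ _)).trans hr) (r.node 0)).2 rfl
      rw [← T.range_shift]
      exact this
  have hfin : (Set.range (fun j => T.shift j (r.node 0))).Finite := Set.finite_range _
  have h1 := Set.ncard_le_ncard hsub (hfin.insert _)
  rw [T.degree] at h1
  have h2 := h1.trans (Set.ncard_insert_le _ _)
  have h3 : (Set.range (fun j => T.shift j (r.node 0))).ncard = q := by
    refine le_antisymm ?_ (by omega)
    rw [← Set.image_univ]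
    exact (Set.ncard_image_le Set.finite_univ).trans (by simp [Set.ncard_univ])
  have h4 : Set.InjOn (fun j => T.shift j (r.node 0)) Set.univ :=
    Set.injOn_of_ncard_image_eq (by rw [Set.image_univ, h3]; simp [Set.ncard_univ])
      Set.finite_univ
  exact Set.injOn_univ.1 h4

theorem shift_bijective : Function.Bijective (fun x : Fin q × V => T.shift x.1 x.2) := by
  constructor
  · rintro ⟨i, s⟩ ⟨j, t⟩ h
    obtain rfl := T.shift_injective_node h
    exact Prod.ext (T.shift_injective_index s h) rfl
  · intro u
    obtain ⟨r, hr, rfl⟩ := exists_ray T.isTree T.infty u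
    obtain ⟨j, hj⟩ := (T.shift_eq_iff r hr (r.node 1)).2 rfl
    exact ⟨⟨j, r.node 1⟩, hj⟩

/-- Every node is, for each `n`, of the form `sw` for exactly one node `s` and one word `w` of
length `n`. -/
theorem act_bijective (n : ℕ) :
    Function.Bijective (fun x : (Fin n → Fin q) × V => T.act (List.ofFn x.1) x.2) := by
  induction n with
  | zero =>
    constructor
    · rintro ⟨w, s⟩ ⟨v, t⟩ h
      have : s = t := by simpa [act] using h
      exact Prod.ext (Subsingleton.elim _ _) this
    · intro u; exact ⟨⟨Fin.elim0, u⟩, by simp [act]⟩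
  | succ n ih =>
    have step (w : Fin (n + 1) → Fin q) (s : V) : T.act (List.ofFn w) s =
        T.act (List.ofFn (Fin.tail w)) (T.shift (w 0) s) := by
      simp [act, List.ofFn_succ, Fin.tail_def]
    constructor
    · rintro ⟨w, s⟩ ⟨v, t⟩ h
      simp only [step] at h
      have h1 := @ih.1 (Fin.tail w, T.shift (w 0) s) (Fin.tail v, T.shift (v 0) t) h
      simp only [Prod.mk.injEq] at h1
      have h2 := @T.shift_bijective.1 (w 0, s) (v 0, t) h1.2
      simp only [Prod.mk.injEq] at h2
      refine Prod.ext ?_ h2.2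
      rw [← Fin.cons_self_tail w, ← Fin.cons_self_tail v, h1.1, h2.1]
    · intro u
      obtain ⟨⟨w, s⟩, rfl⟩ := ih.2 u
      obtain ⟨⟨j, t⟩, rfl⟩ := T.shift_bijective.2 s
      exact ⟨⟨Fin.cons j w, t⟩, by simp only [step]; simp⟩

/-- The primitive shift `α_j` as an operator on `ℓ₂(𝒯)`: `(α_j f)(t) = f(tα_j)`. -/
noncomputable def shiftOp (j : Fin q) : BddOp V :=
  opOfBound ⟨⟨fun f t => f (T.shift j t), fun _ _ => rfl⟩, fun _ _ => rfl⟩ 1 (fun f => by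
    rw [ENNReal.coe_one, one_mul, enorm_sq_eq_tsum f]
    exact ENNReal.tsum_comp_le_tsum_of_injective
      (fun _ _ h => T.shift_injective_node h) (fun t => ‖f t‖ₑ ^ 2))

@[simp] theorem shiftOp_apply (j : Fin q) (f : Ell2 V) (t : V) :
    T.shiftOp j f t = f (T.shift j t) := rfl

/-- The word `w = α_{i₁} ⋯ α_{iₙ}` as an operator on `ℓ₂(𝒯)`. -/
noncomputable def wordOp (w : List (Fin q)) : BddOp V := (w.map T.shiftOp).prod

theorem wordOp_apply (w : List (Fin q)) (f : Ell2 V) (t : V) :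
    T.wordOp w f t = f (T.act w t) := by
  induction w generalizing t with
  | nil => simp [wordOp, act]
  | cons j w ih =>
    have : T.wordOp (j :: w) = T.shiftOp j * T.wordOp w := by simp [wordOp]
    rw [this, mul_apply_eq_comp, shiftOp_apply, ih]
    simp [act]

/-- The algebra `𝐇(𝒯)` of causal operators. -/
def causal : Subalgebra ℂ (BddOp V) where
  carrier := {S | ∀ (s : V) (f : Ell2 V), (∀ t, T.Precedes t s → f t = 0) →
    ∀ t, T.Precedes t s → S f t = 0}
  mul_mem' := fun {A B} hA hB s f hf => hA s (B f) (hB s f hf)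
  add_mem' := fun {A B} hA hB s f hf t ht => by
    simp [hA s f hf t ht, hB s f hf t ht]
  algebraMap_mem' := fun c s f hf t ht => by
    simp [Algebra.algebraMap_eq_smul_one, hf t ht]

/-- The algebra of constants `𝒞 = {S : S, S* ∈ 𝐇(𝒯)}`. -/
def const : Set (BddOp V) := {S | S ∈ T.causal ∧ star S ∈ T.causal}

open Classical in
/-- Existence of the coefficients `S_[w]`. -/
theorem exists_coeff (S : BddOp V) (w : List (Fin q)) :
    ∃ C : BddOp V, ∀ s t, C (chi t) s = if T.Asymp t s then S (chi t) (T.act w s) else 0 := by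
  let Q : Setoid V := ⟨T.Asymp, horoEq_equivalence T.isTree T.infty⟩
  obtain ⟨D, hD, -⟩ := exists_compression (T.wordOp w * S) (Quotient.mk Q) (Quotient.mk Q)
  refine ⟨D, fun s t => ?_⟩
  rw [hD, mul_apply_eq_comp, wordOp_apply]
  have : Quotient.mk Q t = Quotient.mk Q s ↔ T.Asymp t s := Quotient.eq
  simp only [this]

/-- The coefficient `S_[w]` in the expansion `S = ∑_w w* S_[w]` of a causal operator: the bounded
operator with `(S_[w] χ_t)(s) = (S χ_t)(sw)` if `t ≍ s` and `(S_[w] χ_t)(s) = 0` otherwise. -/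
noncomputable def coeff (S : BddOp V) (w : List (Fin q)) : BddOp V :=
  (T.exists_coeff S w).choose

open Classical in
theorem coeff_apply (S : BddOp V) (w : List (Fin q)) (s t : V) :
    T.coeff S w (chi t) s = if T.Asymp t s then S (chi t) (T.act w s) else 0 :=
  (T.exists_coeff S w).choose_spec s t

/-- `∑_{|w| = n} w* S_[w]` -/
noncomputable def homPart (S : BddOp V) (n : ℕ) : BddOp V :=
  ∑ w : Fin n → Fin q, star (T.wordOp (List.ofFn w)) * T.coeff S (List.ofFn w)

/-- The operator `cα = c₁α₁ + ⋯ + c_qα_q`. -/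
noncomputable def rowShift (c : Fin q → BddOp V) : BddOp V := ∑ j, c j * T.shiftOp j

/-- The "unit disk" `𝔹(𝒯)`: rows of constants such that `lim ‖(cα)ⁿ‖^{1/n} < 1`. -/
def ball : Set (Fin q → BddOp V) :=
  {c | (∀ j, c j ∈ T.const) ∧
    ∃ ρ < 1, Tendsto (fun n : ℕ => ‖T.rowShift c ^ n‖ ^ (1 / (n : ℝ))) atTop (𝓝 ρ)}

/-- The point evaluation `S^∧(c) = ∑_n (cα)ⁿ (∑_{|w| = n} w* S_[w])`; for `c ∈ 𝔹(𝒯)` the series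
converges absolutely in the operator norm, see `summable_norm_pointEval`. -/
noncomputable def pointEval (S : BddOp V) (c : Fin q → BddOp V) : BddOp V :=
  ∑' n : ℕ, T.rowShift c ^ n * T.homPart S n

open Classical in
theorem star_wordOp_apply {n : ℕ} (v w : Fin n → Fin q) (g : Ell2 V) (s : V) :
    (star (T.wordOp (List.ofFn v)) g) (T.act (List.ofFn w) s) = if v = w then g s else 0 := by
  have hχ : T.wordOp (List.ofFn v) (chi (T.act (List.ofFn w) s)) =
      if v = w then chi s else 0 := by
    ext t
    rw [wordOp_apply, chi_apply]
    have := (T.act_bijective n).1.eq_iff (a := (v, t)) (b := (w, s))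
    simp only [Prod.mk.injEq] at this
    simp only [this]
    by_cases h : v = w <;> simp [h, chi_apply]
  have hcoord (f : Ell2 V) (t : V) : f t = inner ℂ (chi t) f := by
    rw [chi, lp.inner_single_left]; simp
  rw [hcoord, ContinuousLinearMap.star_eq_adjoint, ContinuousLinearMap.adjoint_inner_right, hχ]
  by_cases h : v = w
  · simp [h, hcoord g s]
  · simp [h]

theorem norm_homPart_le (S : BddOp V) (n : ℕ) : ‖T.homPart S n‖ ≤ ‖S‖ := by
  classical
  let Q : Setoid V := ⟨T.Asymp, horoEq_equivalence T.isTree T.infty⟩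
  let e := Equiv.ofBijective _ (T.act_bijective n)
  obtain ⟨D, hD, hn⟩ := exists_compression S (Quotient.mk Q)
    (fun r => Quotient.mk Q (e.symm r).2)
  suffices h : T.homPart S n = D by rwa [h]
  refine op_ext fun t => ?_
  ext r
  obtain ⟨⟨w, s⟩, rfl⟩ := e.surjective r
  rw [hD, Equiv.symm_apply_apply]
  have h1 : Quotient.mk Q t = Quotient.mk Q s ↔ T.Asymp t s := Quotient.eq
  simp only [h1]
  have h2 : e (w, s) = T.act (List.ofFn w) s := rfl
  rw [h2, homPart, _root_.sum_apply, lp.coeFn_sum, Finset.sum_apply]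
  simp only [mul_apply_eq_comp, star_wordOp_apply, coeff_apply]
  simp

theorem summable_norm_rowShift_pow {c : Fin q → BddOp V} (hc : c ∈ T.ball) :
    Summable fun n : ℕ => ‖T.rowShift c ^ n‖ := by
  obtain ⟨-, ρ, hρ, hlim⟩ := hc
  have hρ0 : 0 ≤ ρ := ge_of_tendsto' hlim fun n => by positivity
  obtain ⟨x, hx, hx1⟩ := exists_between hρ
  have hx0 := hρ0.trans hx.le
  refine Summable.of_norm_bounded_eventually_nat (summable_geometric_of_lt_one hx0 hx1) ?_
  filter_upwards [hlim.eventually_lt_const hx, eventually_ge_atTop 1] with n hn hn1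
  rw [norm_norm]
  have h := Real.rpow_le_rpow (by positivity) hn.le (Nat.cast_nonneg n)
  rwa [← Real.rpow_mul (norm_nonneg _), one_div, inv_mul_cancel₀ (by positivity), Real.rpow_one,
    Real.rpow_natCast] at h

/-- The series that defines the point evaluation converges absolutely in the operator norm. -/
theorem summable_norm_pointEval (S : BddOp V) {c : Fin q → BddOp V} (hc : c ∈ T.ball) :
    Summable fun n : ℕ => ‖T.rowShift c ^ n * T.homPart S n‖ := by
  refine Summable.of_nonneg_of_le (fun _ => norm_nonneg _) (fun n => ?_)
    ((T.summable_norm_rowShift_pow hc).mul_right ‖S‖)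
  exact (norm_mul_le _ _).trans (by gcongr; exact T.norm_homPart_le S n)

theorem isUnit_one_sub {c : Fin q → BddOp V} (hc : c ∈ T.ball) :
    IsUnit (1 - star (T.rowShift c)) := by
  have hs := (T.summable_norm_rowShift_pow hc).of_norm
  have h0 : Tendsto (fun n => T.rowShift c ^ n) atTop (𝓝 0) := hs.tendsto_atTop_zero
  have hu : IsUnit (1 - T.rowShift c) := by
    rw [isUnit_iff_exists]
    refine ⟨∑' n, T.rowShift c ^ n, ?_, ?_⟩
    · refine tendsto_nhds_unique
        (((hs.hasSum.tendsto_sum_nat).const_mul (1 - T.rowShift c))) ?_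
      simp_rw [mul_neg_geom_sum]
      simpa using h0.const_sub 1
    · refine tendsto_nhds_unique
        (((hs.hasSum.tendsto_sum_nat).mul_const (1 - T.rowShift c))) ?_
      simp_rw [geom_sum_mul_neg]
      simpa using h0.const_sub 1
  simpa using hu.star

/-- The kernel `K^c_∧ = (I - α* c*)⁻¹`, where `α* c* = (cα)*`; for `c ∈ 𝔹(𝒯)` the operator
`I - α* c*` is invertible, see `isUnit_one_sub`. -/
noncomputable def kernelOp (c : Fin q → BddOp V) : BddOp V :=
  Ring.inverse (1 - star (T.rowShift c))

/-- The kernel `K_S^c = (I - S S^∧(c)*) K^c_∧`. -/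
noncomputable def schurKernelOp (S : BddOp V) (c : Fin q → BddOp V) : BddOp V :=
  (1 - S * star (T.pointEval S c)) * T.kernelOp c

theorem summable_sq_comp (S F : BddOp V) (h : Summable fun t => ‖F (chi t)‖ ^ 2) :
    Summable fun t => ‖(S * F) (chi t)‖ ^ 2 := by
  refine Summable.of_nonneg_of_le (fun _ => by positivity) (fun t => ?_) (h.mul_left (‖S‖ ^ 2))
  rw [← mul_pow]
  gcongr
  exact S.le_opNorm _

/-- The subspace of causal operators `F` with `trace(F* F) = ∑_t ‖F χ_t‖² < ∞`. -/
def hilbertSchmidt : Submodule ℂ (BddOp V) where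
  carrier := {F | F ∈ T.causal ∧ Summable fun t => ‖F (chi t)‖ ^ 2}
  zero_mem' := ⟨T.causal.zero_mem, by simp⟩
  add_mem' := fun {A B} hA hB => ⟨T.causal.add_mem hA.1 hB.1, by
    refine Summable.of_nonneg_of_le (fun _ => by positivity) (fun t => ?_)
      ((hA.2.mul_left 2).add (hB.2.mul_left 2))
    have h := norm_add_le (A (chi t)) (B (chi t))
    rw [_root_.add_apply]
    nlinarith [sq_nonneg (‖A (chi t)‖ - ‖B (chi t)‖), norm_nonneg (A (chi t) + B (chi t))]⟩
  smul_mem' := fun c A hA => ⟨T.causal.smul_mem hA.1 c, by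
    simpa [norm_smul, mul_pow] using hA.2.mul_left (‖c‖ ^ 2)⟩

/-- The space `𝐇₂(𝒯)` of causal Hilbert–Schmidt operators; it carries the Hilbert–Schmidt norm and
inner product (below) instead of the operator norm. -/
structure H2 where
  toSub : T.hilbertSchmidt

namespace H2

variable {T}

variable (T) in
/-- `𝐇₂(𝒯)` as a vector space. -/
def equivSub : T.H2 ≃ T.hilbertSchmidt := ⟨toSub, H2.mk, fun _ => rfl, fun _ => rfl⟩

noncomputable instance : AddCommGroup T.H2 := (equivSub T).addCommGroup

noncomputable instance : Module ℂ T.H2 := (equivSub T).module ℂ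

variable (T) in
/-- The operator on `ℓ₂(𝒯)` underlying an element of `𝐇₂(𝒯)`. -/
noncomputable def op : T.H2 →ₗ[ℂ] BddOp V where
  toFun F := F.toSub
  map_add' _ _ := rfl
  map_smul' _ _ := rfl

theorem op_injective : Function.Injective (op T) := fun _ _ h =>
  (equivSub T).injective (Subtype.ext h)

theorem causal_op (F : T.H2) : op T F ∈ T.causal := F.toSub.2.1

theorem summable_op (F : T.H2) : Summable fun t => ‖op T F (chi t)‖ ^ 2 := F.toSub.2.2

/-- The element of `𝐇₂(𝒯)` given by a causal Hilbert–Schmidt operator. -/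
def ofOp (A : BddOp V) (hA : A ∈ T.causal) (h : Summable fun t => ‖A (chi t)‖ ^ 2) : T.H2 :=
  ⟨⟨A, hA, h⟩⟩

@[simp] theorem op_ofOp (A : BddOp V) (hA : A ∈ T.causal) (h) : op T (ofOp A hA h) = A := rfl

/-- The columns `F χ_t` of `F`. -/
noncomputable def columns : T.H2 →ₗ[ℂ] lp (fun _ : V => Ell2 V) 2 where
  toFun F := ⟨fun t => op T F (chi t), memℓp_gen (by simpa using summable_op F)⟩
  map_add' _ _ := rfl
  map_smul' _ _ := rfl

theorem columns_apply (F : T.H2) (t : V) : columns F t = op T F (chi t) := rfl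

theorem columns_injective : Function.Injective (columns (T := T)) := fun _ _ h =>
  op_injective (op_ext fun t => congrFun (congrArg Subtype.val h) t)

/-- The Hilbert–Schmidt norm, see `norm_sq_eq`. -/
noncomputable instance : NormedAddCommGroup T.H2 :=
  NormedAddCommGroup.induced T.H2 (lp (fun _ : V => Ell2 V) 2) columns columns_injective

noncomputable instance : NormedSpace ℂ T.H2 :=
  NormedSpace.induced ℂ T.H2 (lp (fun _ : V => Ell2 V) 2) columns

theorem norm_columns (F : T.H2) : ‖columns F‖ = ‖F‖ := rfl

/-- The inner product of `𝐇₂(𝒯)`, conjugate-linear in the first argument: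
`inner F G = trace(F* G) = ∑_t ⟪F χ_t, G χ_t⟫`. -/
noncomputable instance : Inner ℂ T.H2 :=
  ⟨fun F G => ∑' t, inner ℂ (op T F (chi t)) (op T G (chi t))⟩

theorem inner_eq_columns (F G : T.H2) : inner ℂ F G = inner ℂ (columns F) (columns G) := by
  rw [lp.inner_eq_tsum]; rfl

noncomputable instance : InnerProductSpace ℂ T.H2 where
  norm_sq_eq_re_inner F := by
    rw [inner_eq_columns, ← norm_columns]; exact norm_sq_eq_re_inner _
  conj_inner_symm F G := by simp only [inner_eq_columns]; exact inner_conj_symm _ _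
  add_left F G H := by simp only [inner_eq_columns, map_add, inner_add_left]
  smul_left F G c := by simp only [inner_eq_columns, map_smul, inner_smul_left]

theorem inner_def (F G : T.H2) :
    inner ℂ F G = ∑' t, inner ℂ (op T F (chi t)) (op T G (chi t)) := rfl

theorem norm_sq_eq (F : T.H2) : ‖F‖ ^ 2 = ∑' t, ‖op T F (chi t)‖ ^ 2 := by
  have := lp.norm_rpow_eq_tsum (p := 2) (by norm_num) (columns F)
  simpa [norm_columns, columns_apply] using this

theorem norm_op_le (F : T.H2) : ‖op T F‖ ≤ ‖F‖ := by
  refine ContinuousLinearMap.opNorm_le_bound _ (norm_nonneg _) fun f => ?_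
  have h1 : HasSum (fun t => f t • op T F (chi t)) (op T F f) := by
    simpa using (hasSum_chi f).mapL (op T F)
  have hf := (lp.memℓp f).summable (by norm_num)
  have hf' := lp.norm_rpow_eq_tsum (p := 2) (by norm_num) f
  simp only [ENNReal.toReal_ofNat, Real.rpow_ofNat] at hf hf'
  have h23 := Real.summable_and_inner_le_Lp_mul_Lq_tsum_of_nonneg (p := 2) (q := 2)
    (f := fun t => ‖f t‖) (g := fun t => ‖op T F (chi t)‖) Real.HolderConjugate.two_two
    (fun _ => norm_nonneg _) (fun _ => norm_nonneg _)
    (by simpa using hf) (by simpa using summable_op F)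
  obtain ⟨h2, h3⟩ := h23
  have h4 : ‖op T F f‖ ≤ ∑' t, ‖f t‖ * ‖op T F (chi t)‖ := by
    rw [← h1.tsum_eq]
    refine (norm_tsum_le_tsum_norm ?_).trans_eq ?_ <;> simp only [norm_smul]
    exact h2
  refine h4.trans (h3.trans_eq ?_)
  simp only [Real.rpow_ofNat]
  rw [← hf', ← norm_sq_eq, ← Real.sqrt_eq_rpow, ← Real.sqrt_eq_rpow,
    Real.sqrt_sq (norm_nonneg _), Real.sqrt_sq (norm_nonneg _), mul_comm]

instance : CompleteSpace T.H2 := by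
  refine Metric.complete_of_cauchySeq_tendsto fun u hu => ?_
  have hop : CauchySeq fun n => op T (u n) := by
    exact (AddMonoidHomClass.lipschitz_of_bound (op T) 1
      fun F => by simpa using norm_op_le F).uniformContinuous.comp_cauchySeq hu
  have hcol : CauchySeq fun n => columns (u n) := by
    exact (AddMonoidHomClass.lipschitz_of_bound (columns (T := T)) 1
      fun F => by simpa using (norm_columns F).le).uniformContinuous.comp_cauchySeq hu
  obtain ⟨A, hA⟩ := cauchySeq_tendsto_of_complete hop
  obtain ⟨g, hg⟩ := cauchySeq_tendsto_of_complete hcol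
  have happ (f : Ell2 V) : Tendsto (fun n => op T (u n) f) atTop (𝓝 (A f)) :=
    ((ContinuousLinearMap.apply ℂ (Ell2 V) f).continuous.tendsto A).comp hA
  have hval (t : V) (f : ℕ → Ell2 V) (f₀ : Ell2 V) (h : Tendsto f atTop (𝓝 f₀)) :
      Tendsto (fun n => f n t) atTop (𝓝 (f₀ t)) := by
    rw [tendsto_iff_norm_sub_tendsto_zero] at h ⊢
    exact squeeze_zero (fun _ => norm_nonneg _)
      (fun n => lp.norm_apply_le_norm (by norm_num) (f n - f₀) t) h
  have hcolt (t : V) : Tendsto (fun n => op T (u n) (chi t)) atTop (𝓝 (g t)) := by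
    have h := hg
    rw [tendsto_iff_norm_sub_tendsto_zero] at h ⊢
    exact squeeze_zero (fun _ => norm_nonneg _)
      (fun n => lp.norm_apply_le_norm (by norm_num) (columns (u n) - g) t) h
  have hAg (t : V) : A (chi t) = g t := tendsto_nhds_unique (happ _) (hcolt t)
  have hcausal : A ∈ T.causal := fun s f hf t ht => by
    refine tendsto_nhds_unique (hval t _ _ (happ f)) ?_
    simp only [causal_op (u _) s f hf t ht, tendsto_const_nhds]
  have hsum : Summable fun t => ‖A (chi t)‖ ^ 2 := by
    have := (lp.memℓp g).summable (by norm_num)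
    simpa [hAg] using this
  refine ⟨ofOp A hcausal hsum, ?_⟩
  have hcol' : columns (ofOp A hcausal hsum) = g := by
    ext t : 2
    exact hAg t
  rw [tendsto_iff_norm_sub_tendsto_zero] at hg ⊢
  simpa only [← hcol', ← map_sub, norm_columns] using hg

variable (T) in
/-- The space `𝒞₂ = 𝒞 ∩ 𝐇₂(𝒯)`. -/
def const : Set T.H2 := {F | op T F ∈ T.const}

end H2

/-- The product `S F` as an element of `𝐇₂(𝒯)`. -/
noncomputable def mulFun (S : T.causal) (F : T.H2) : T.H2 :=
  H2.ofOp ((S : BddOp V) * H2.op T F) (T.causal.mul_mem S.2 (H2.causal_op F))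
    (summable_sq_comp (S : BddOp V) (H2.op T F) (H2.summable_op F))

theorem op_mulFun (S : T.causal) (F : T.H2) :
    H2.op T (T.mulFun S F) = (S : BddOp V) * H2.op T F := rfl

theorem mulFun_add (S : T.causal) (F G : T.H2) :
    T.mulFun S (F + G) = T.mulFun S F + T.mulFun S G := by
  apply H2.op_injective
  rw [map_add (H2.op T), op_mulFun, op_mulFun, op_mulFun, map_add (H2.op T)]
  exact mul_add (S : BddOp V) _ _

theorem mulFun_smul (S : T.causal) (c : ℂ) (F : T.H2) :
    T.mulFun S (c • F) = c • T.mulFun S F := by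
  apply H2.op_injective
  rw [map_smul (H2.op T), op_mulFun, op_mulFun, map_smul (H2.op T)]
  exact ContinuousLinearMap.ext fun f => map_smul (S : BddOp V) c _

theorem norm_mulFun_le (S : T.causal) (F : T.H2) :
    ‖T.mulFun S F‖ ≤ ‖(S : BddOp V)‖ * ‖F‖ := by
  have h1 : ‖T.mulFun S F‖ ^ 2 = ∑' t, ‖((S : BddOp V) * H2.op T F) (chi t)‖ ^ 2 :=
    H2.norm_sq_eq _
  have h2 := summable_sq_comp (S : BddOp V) (H2.op T F) (H2.summable_op F)
  have h3 := (H2.summable_op F).mul_left (‖(S : BddOp V)‖ ^ 2)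
  have h4 (t : V) : ‖((S : BddOp V) * H2.op T F) (chi t)‖ ^ 2 ≤
      ‖(S : BddOp V)‖ ^ 2 * ‖H2.op T F (chi t)‖ ^ 2 := by
    rw [← mul_pow]
    exact pow_le_pow_left₀ (norm_nonneg _) ((S : BddOp V).le_opNorm _) 2
  have h5 := h2.tsum_le_tsum h4 h3
  rw [← h1, tsum_mul_left, ← H2.norm_sq_eq, ← mul_pow] at h5
  exact (sq_le_sq₀ (norm_nonneg _) (by positivity)).1 h5

/-- The left multiplication operator `M_S F = S F` on `𝐇₂(𝒯)`. -/
noncomputable def mulLeft (S : T.causal) : T.H2 →L[ℂ] T.H2 :=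
  LinearMap.mkContinuous ⟨⟨T.mulFun S, T.mulFun_add S⟩, T.mulFun_smul S⟩ ‖(S : BddOp V)‖ (T.norm_mulFun_le S)

@[simp] theorem op_mulLeft (S : T.causal) (F : T.H2) :
    H2.op T (T.mulLeft S F) = S * H2.op T F := rfl

theorem norm_mulLeft_le (S : T.causal) : ‖T.mulLeft S‖ ≤ ‖(S : BddOp V)‖ :=
  LinearMap.mkContinuous_norm_le _ (norm_nonneg _) _

/-- A Schur multiplier: a causal operator `S` with `‖S‖ ≤ 1`. -/
structure SchurMultiplier where
  op : BddOp V
  causal : op ∈ T.causal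
  norm_le : ‖op‖ ≤ 1

namespace SchurMultiplier

variable {T} (S : T.SchurMultiplier)

/-- The operator `M_S` on `𝐇₂(𝒯)`. -/
noncomputable def mul : T.H2 →L[ℂ] T.H2 := T.mulLeft ⟨S.op, S.causal⟩

/-- The operator `ℬ_S = I - M_S M_S*` on `𝐇₂(𝒯)`. -/
noncomputable def defect : T.H2 →L[ℂ] T.H2 := 1 - S.mul * star S.mul

/-- The positive square root `√ℬ_S`. -/
noncomputable def sqrtDefect : T.H2 →L[ℂ] T.H2 := CFC.sqrt S.defect

/-- The orthogonal projection `π_S` in `𝐇₂(𝒯)` onto `ker ℬ_S`. -/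
noncomputable def kerProj : T.H2 →L[ℂ] T.H2 := S.defect.ker.starProjection

theorem defect_nonneg : 0 ≤ S.defect := by
  have h1 : ‖star S.mul‖ ≤ 1 := by
    refine (norm_star S.mul).le.trans ?_
    exact (T.norm_mulLeft_le _).trans S.norm_le
  have h2 : star (star S.mul) * star S.mul ≤ algebraMap ℝ (T.H2 →L[ℂ] T.H2) (‖star S.mul‖ ^ 2) :=
    CStarAlgebra.star_mul_le_algebraMap_norm_sq
  rw [star_star] at h2
  rw [defect, sub_nonneg]
  refine h2.trans ?_
  rw [← map_one (algebraMap ℝ (T.H2 →L[ℂ] T.H2))]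
  exact algebraMap_mono _ (pow_le_one₀ (norm_nonneg _) h1)

theorem sqrtDefect_mul_self : S.sqrtDefect * S.sqrtDefect = S.defect :=
  CFC.sqrt_mul_sqrt_self _ S.defect_nonneg

theorem sqrtDefect_eq_zero_iff (F : T.H2) : S.sqrtDefect F = 0 ↔ S.defect F = 0 := by
  have hsa : star S.sqrtDefect = S.sqrtDefect :=
    (IsSelfAdjoint.of_nonneg (CFC.sqrt_nonneg S.defect)).star_eq
  have hB : S.defect F = S.sqrtDefect (S.sqrtDefect F) := by
    rw [← sqrtDefect_mul_self]; rfl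
  constructor
  · intro h; rw [hB, h, map_zero]
  · intro h
    rw [hB] at h
    have : inner ℂ (S.sqrtDefect F) (S.sqrtDefect F) = 0 := by
      nth_rw 1 [← hsa]
      rw [ContinuousLinearMap.star_eq_adjoint, ContinuousLinearMap.adjoint_inner_left, h,
        inner_zero_right]
    exact inner_self_eq_zero.1 this

theorem kerProj_eq_self_iff (F : T.H2) : (1 - S.kerProj) F = 0 ↔ S.sqrtDefect F = 0 := by
  rw [sqrtDefect_eq_zero_iff]
  change F - S.kerProj F = 0 ↔ _
  rw [sub_eq_zero, eq_comm, kerProj, Submodule.starProjection_eq_self_iff]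
  rfl

theorem compl_eq_iff (F G : T.H2) :
    (1 - S.kerProj) F = (1 - S.kerProj) G ↔ S.sqrtDefect F = S.sqrtDefect G := by
  rw [← sub_eq_zero, ← map_sub, kerProj_eq_self_iff, map_sub, sub_eq_zero]

/-- The map `√ℬ_S F ↦ (I - π_S) F`. -/
noncomputable def liftAux : S.sqrtDefect.range →ₗ[ℂ] T.H2 where
  toFun u := (1 - S.kerProj) u.2.choose
  map_add' u v := by
    rw [← map_add, compl_eq_iff, map_add]
    exact (u + v).2.choose_spec.trans
      (congrArg₂ (· + ·) u.2.choose_spec v.2.choose_spec).symm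
  map_smul' c u := by
    rw [RingHom.id_apply, ← map_smul, compl_eq_iff, map_smul]
    exact (c • u).2.choose_spec.trans (congrArg (c • ·) u.2.choose_spec).symm

theorem liftAux_apply (F : T.H2) (h) : S.liftAux ⟨S.sqrtDefect F, h⟩ = (1 - S.kerProj) F :=
  (S.compl_eq_iff _ _).2 h.choose_spec

theorem liftAux_injective : Function.Injective S.liftAux := by
  rintro ⟨_, F, rfl⟩ ⟨_, G, rfl⟩ h
  refine Subtype.ext ((S.compl_eq_iff F G).1 ?_)
  exact (S.liftAux_apply F _).symm.trans (h.trans (S.liftAux_apply G _))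

/-- The de Branges–Rovnyak space `𝐇(S) = √ℬ_S 𝐇₂(𝒯)`; it carries the norm
`‖√ℬ_S F‖ = ‖(I - π_S) F‖₂` (below) instead of the norm of `𝐇₂(𝒯)`. -/
structure DBR where
  toSub : S.sqrtDefect.range

namespace DBR

variable {S}

variable (S) in
/-- `𝐇(S)` as a vector space. -/
def equivSub : S.DBR ≃ S.sqrtDefect.range := ⟨toSub, DBR.mk, fun _ => rfl, fun _ => rfl⟩

noncomputable instance : AddCommGroup S.DBR := (equivSub S).addCommGroup

noncomputable instance : Module ℂ S.DBR := (equivSub S).module ℂ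

variable (S) in
/-- The inclusion of `𝐇(S)` in `𝐇₂(𝒯)`. -/
noncomputable def incl : S.DBR →ₗ[ℂ] T.H2 where
  toFun u := u.toSub
  map_add' _ _ := rfl
  map_smul' _ _ := rfl

theorem incl_injective : Function.Injective (incl S) := fun _ _ h =>
  (equivSub S).injective (Subtype.ext h)

variable (S) in
/-- The element `√ℬ_S F` of `𝐇(S)`. -/
noncomputable def ofH2 (F : T.H2) : S.DBR := ⟨⟨S.sqrtDefect F, F, rfl⟩⟩

theorem incl_ofH2 (F : T.H2) : incl S (ofH2 S F) = S.sqrtDefect F := rfl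

theorem exists_eq_ofH2 (u : S.DBR) : ∃ F, ofH2 S F = u := by
  obtain ⟨_, F, rfl⟩ := u
  exact ⟨F, rfl⟩

/-- The map `√ℬ_S F ↦ (I - π_S) F`. -/
noncomputable def lift : S.DBR →ₗ[ℂ] T.H2 where
  toFun u := S.liftAux u.toSub
  map_add' u v := S.liftAux.map_add u.toSub v.toSub
  map_smul' c u := S.liftAux.map_smul c u.toSub

theorem lift_ofH2 (F : T.H2) : lift (ofH2 S F) = (1 - S.kerProj) F := S.liftAux_apply F _

theorem lift_injective : Function.Injective (lift (S := S)) :=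
  S.liftAux_injective.comp (equivSub S).injective

/-- The norm `‖√ℬ_S F‖ = ‖(I - π_S) F‖₂`, see `norm_ofH2`. -/
noncomputable instance : NormedAddCommGroup S.DBR :=
  NormedAddCommGroup.induced S.DBR T.H2 lift lift_injective

noncomputable instance : NormedSpace ℂ S.DBR := NormedSpace.induced ℂ S.DBR T.H2 lift

/-- The inner product of `𝐇(S)`, conjugate-linear in the first argument, see `inner_ofH2`. -/
noncomputable instance : InnerProductSpace ℂ S.DBR where
  inner u v := inner ℂ (lift u) (lift v)
  norm_sq_eq_re_inner u := norm_sq_eq_re_inner (lift u)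
  conj_inner_symm u v := inner_conj_symm (lift u) (lift v)
  add_left u v w := by rw [map_add, inner_add_left]
  smul_left u v c := by rw [map_smul, inner_smul_left]

theorem norm_ofH2 (F : T.H2) : ‖ofH2 S F‖ = ‖(1 - S.kerProj) F‖ := by
  rw [← lift_ofH2]; rfl

theorem inner_ofH2 (F G : T.H2) : inner ℂ (ofH2 S F) (ofH2 S G) =
    inner ℂ ((1 - S.kerProj) F) ((1 - S.kerProj) G) := by
  rw [← lift_ofH2, ← lift_ofH2]; rfl

end DBR

end SchurMultiplier

/-- Right `𝒞`-invariance of a space `H` of elements of `𝐇₂(𝒯)`, given together with its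
inclusion `ι : H → 𝐇₂(𝒯)`: for all `F, G ∈ H` and `c ∈ 𝒞` one has `F c ∈ H`,
`‖F c‖ ≤ ‖F‖ ‖c‖` and `⟨F c, G⟩ = ⟨F, G c*⟩`. -/
def RightConstInvariant {H : Type*} [NormedAddCommGroup H] [InnerProductSpace ℂ H]
    (ι : H →ₗ[ℂ] T.H2) : Prop :=
  Function.Injective ι ∧ ∀ c ∈ T.const, ∀ F G : H, ∃ Fc Gc : H,
    H2.op T (ι Fc) = H2.op T (ι F) * c ∧ H2.op T (ι Gc) = H2.op T (ι G) * star c ∧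
    ‖Fc‖ ≤ ‖F‖ * ‖c‖ ∧ inner ℂ Fc G = inner ℂ F Gc

end HomogeneousTree

/-! ### Matrix entries of operators on `ℓ₂(𝒯)` -/

section Ell2Lemmas

variable {V : Type*}

/-! Sort the matrix entries `(A χ_t)(s)` by the level of `s` minus the level of `t`, where the level
is the Busemann function of the boundary point. Causal operators live on the diagonals of index `≥
0`, constants on diagonal `0`, and `cα` on diagonal `-1`. Put `R = (I - cα)⁻¹ = ∑ (cα)ⁿ`. The
central fact, `suppIn_sub_pointEval`, is that for causal `S` the operator `R (S - S^∧(c))` has only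
diagonals of positive index. In particular `S^∧(c)` is the zeroth diagonal of `R S`
(`pointEval_entry`).

Let `K = R*` and let `k` be a constant. Pairing with `k` sees only the zeroth diagonal, so `⟨F, K
k⟩₂ = trace(k* R F) = ⟨F^∧(c), k⟩₂`. For causal `F` the operator `R (S - S^∧(c)) F` is again
strictly causal, which gives `M_S* K k = S^∧(c)* K k` and hence `K_S^c k = ℬ_S (K k)`. The
reproducing property in `𝐇(S)` then follows from the general identity `⟨F, ℬ_S G⟩ = ⟨F, G⟩₂` for `F`
in `𝐇(S)` (`inner_ofH2_sqrtDefect`).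

Completeness holds because `√ℬ_S F ↦ (I - π_S) F` is an isometry onto the closed subspace `(ker
ℬ_S)ᗮ`. Right invariance holds because right multiplication by a constant commutes with `M_S` and
`M_S*`, hence with `√ℬ_S` and `π_S`.

For density, let `F` be orthogonal to all kernels. The choice `k = F^∧(c)` gives `F^∧(c) = 0` for
every `c`. Rows `c` for which `cα` is a nilpotent shift along a finite path recover every entry of
`F`, so `F = 0` (`eq_zero_of_pointEval`). -/

theorem inner_chi_left (f : Ell2 V) (t : V) : inner ℂ (chi t) f = f t := by
  classical
  rw [chi, lp.inner_single_left]; simp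

theorem inner_chi_right (f : Ell2 V) (t : V) : inner ℂ f (chi t) = star (f t) := by
  rw [← inner_chi_left f t, ← inner_conj_symm]; rfl

theorem star_entry (A : BddOp V) (s t : V) : (star A) (chi t) s = star (A (chi s) t) := by
  rw [← inner_chi_left, ContinuousLinearMap.star_eq_adjoint,
    ContinuousLinearMap.adjoint_inner_right, inner_chi_right]

theorem hasSum_entry (A : BddOp V) (f : Ell2 V) (s : V) :
    HasSum (fun t => f t * A (chi t) s) (A f s) := by
  have h := ((hasSum_chi f).mapL A).mapL (innerSL ℂ (chi s : Ell2 V))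
  simpa [inner_chi_left, inner_smul_right] using h

/-- The matrix entry `A ↦ (A χ_t)(s)` as a continuous linear functional. -/
noncomputable def entryCLM (s t : V) : BddOp V →L[ℂ] ℂ :=
  (innerSL ℂ (chi s : Ell2 V)).comp (ContinuousLinearMap.apply ℂ (Ell2 V) (chi t : Ell2 V))

theorem entryCLM_apply (s t : V) (A : BddOp V) : entryCLM s t A = A (chi t) s := by
  simp [entryCLM, inner_chi_left]

theorem op_ext_entry {A B : BddOp V} (h : ∀ s t, A (chi t) s = B (chi t) s) : A = B :=
  op_ext fun t => by ext s; exact h s t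

theorem norm_le_of_entry_le {f g : Ell2 V} (h : ∀ s, ‖f s‖ ≤ ‖g s‖) : ‖f‖ ≤ ‖g‖ := by
  have := norm_le_of_tsum (f := g) (g := f) (C := 1) (by
    rw [ENNReal.coe_one, one_mul, enorm_sq_eq_tsum]
    refine ENNReal.tsum_le_tsum fun s => ?_
    gcongr
    exact enorm_le_iff_norm_le.2 (h s))
  simpa using this

theorem inner_congr_right {f g h : Ell2 V} (H : ∀ s, f s ≠ 0 → g s = h s) :
    inner ℂ f g = (inner ℂ f h : ℂ) := by
  rw [lp.inner_eq_tsum, lp.inner_eq_tsum]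
  refine tsum_congr fun s => ?_
  by_cases hs : f s = 0
  · simp [hs]
  · rw [H s hs]

end Ell2Lemmas

namespace HomogeneousTree

variable {q : ℕ} {V : Type*} (T : HomogeneousTree q V)

/-! ### Levels of nodes -/

section Level

/-- Each path is compared with one fixed representative of the boundary point: if it coincides from
index `m` on with the representative from index `n` on, its first node gets level `m - n`. By
`coincide_diff` this does not depend on the choice of `m` and `n`. -/
theorem exists_level : ∃ l : V → ℤ, ∀ r r' : GraphRay T.graph, ⟦r⟧ = T.infty → ⟦r'⟧ = T.infty →
    ∀ m n, r.Coincide r' m n → l (r.node 0) - l (r'.node 0) = m - n := by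
  obtain ⟨r₀, h₀⟩ := Quotient.exists_rep T.infty
  have h (t : V) : ∃ d : ℤ, ∀ r : GraphRay T.graph, ⟦r⟧ = T.infty → r.node 0 = t →
      ∀ m n, r.Coincide r₀ m n → (m : ℤ) - n = d := by
    obtain ⟨r, hr, rfl⟩ := exists_ray T.isTree T.infty t
    obtain ⟨m, n, hc⟩ := Quotient.exact (hr.trans h₀.symm)
    refine ⟨m - n, fun r' hr' h m' n' hc' => ?_⟩
    obtain rfl := GraphRay.eq_of_equiv T.isTree (Quotient.exact (hr'.trans hr.symm)) h
    have := coincide_diff T.isTree hc hc'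
    omega
  choose l hl using h
  refine ⟨l, fun r r' hr hr' m n hc => ?_⟩
  obtain ⟨m', n', hc'⟩ := Quotient.exact (hr'.trans h₀.symm)
  have hc'' : r.Coincide r₀ (m + m') (n' + n) := fun k => by
    rw [Nat.add_assoc, hc, Nat.add_left_comm, hc', Nat.add_assoc]
  have h1 := hl _ r hr rfl _ _ hc''
  have h2 := hl _ r' hr' rfl _ _ hc'
  push_cast at h1
  omega

/-- The level (Busemann function) of a node: levels are the horocycles, and they increase by one
under the primitive shifts. -/
noncomputable def level : V → ℤ := T.exists_level.choose

theorem level_sub {r r' : GraphRay T.graph} (hr : ⟦r⟧ = T.infty) (hr' : ⟦r'⟧ = T.infty) {m n : ℕ}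
    (h : r.Coincide r' m n) : T.level (r.node 0) - T.level (r'.node 0) = m - n :=
  T.exists_level.choose_spec r r' hr hr' m n h

theorem precedes_iff (s t : V) : T.Precedes s t ↔ T.level s ≤ T.level t := by
  obtain ⟨r, hr, rfl⟩ := exists_ray T.isTree T.infty s
  obtain ⟨r', hr', rfl⟩ := exists_ray T.isTree T.infty t
  obtain ⟨m, n, hc⟩ := Quotient.exact (hr.trans hr'.symm)
  have := T.level_sub hr hr' hc
  rw [Precedes, horoLE_iff T.isTree hr hr' hc]
  omega

theorem asymp_iff (s t : V) : T.Asymp s t ↔ T.level s = T.level t := by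
  obtain ⟨r, hr, rfl⟩ := exists_ray T.isTree T.infty s
  obtain ⟨r', hr', rfl⟩ := exists_ray T.isTree T.infty t
  obtain ⟨m, n, hc⟩ := Quotient.exact (hr.trans hr'.symm)
  have := T.level_sub hr hr' hc
  rw [Asymp, horoEq_iff T.isTree hr hr' hc]
  omega

theorem level_node_one {r : GraphRay T.graph} (hr : ⟦r⟧ = T.infty) :
    T.level (r.node 1) = T.level (r.node 0) - 1 := by
  have := T.level_sub (r := r.tail) (r' := r) ((Quotient.sound r.tail_equiv).trans hr) hr
    (m := 0) (n := 1) (fun k => by simp [GraphRay.tail, Nat.add_comm])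
  have h : r.tail.node 0 = r.node 1 := rfl
  rw [h] at this
  push_cast at this
  omega

theorem level_shift (j : Fin q) (t : V) : T.level (T.shift j t) = T.level t + 1 := by
  obtain ⟨r, hr, h0⟩ := exists_ray T.isTree T.infty (T.shift j t)
  have h1 := (T.shift_eq_iff r hr t).1 ⟨j, h0.symm⟩
  have := T.level_node_one hr
  rw [h1, h0] at this
  omega

theorem level_act (w : List (Fin q)) (t : V) : T.level (T.act w t) = T.level t + w.length := by
  induction w generalizing t with
  | nil => simp [act]
  | cons j w ih =>
    have : T.act (j :: w) t = T.act w (T.shift j t) := rfl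
    rw [this, ih, level_shift, List.length_cons]
    push_cast
    ring

end Level

/-- The matrix entries of `A` outside the diagonals whose index belongs to `D` vanish. -/
def SuppIn (D : Set ℤ) (A : BddOp V) : Prop :=
  ∀ s t, T.level s - T.level t ∉ D → A (chi t) s = 0

/-! ### Calculus of diagonals -/

namespace SuppIn

variable {T} {D E F : Set ℤ} {A B : BddOp V}

theorem mono (h : T.SuppIn D A) (hDE : D ⊆ E) : T.SuppIn E A :=
  fun s t hst => h s t fun h => hst (hDE h)

theorem apply_eq_zero (h : T.SuppIn D A) {f : Ell2 V} {s : V}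
    (hf : ∀ t, T.level s - T.level t ∈ D → f t = 0) : A f s = 0 := by
  refine (hasSum_entry A f s).unique ?_
  convert hasSum_zero using 2 with t
  by_cases hst : T.level s - T.level t ∈ D
  · rw [hf t hst, zero_mul]
  · rw [h s t hst, mul_zero]

theorem mul (hA : T.SuppIn D A) (hB : T.SuppIn E B) (h : ∀ d ∈ D, ∀ e ∈ E, d + e ∈ F) :
    T.SuppIn F (A * B) := fun s t hst => by
  refine hA.apply_eq_zero fun u hu => hB u t fun hut => hst ?_
  have := h _ hu _ hut
  rwa [sub_add_sub_cancel] at this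

theorem star (hA : T.SuppIn D A) (h : ∀ d ∈ D, -d ∈ E) : T.SuppIn E (star A) :=
  fun s t hst => by
    rw [star_entry, hA t s, star_zero]
    intro hts
    exact hst (by simpa using h _ hts)

theorem of_hasSum {ι : Type*} {u : ι → BddOp V} (hA : HasSum u A) (h : ∀ i, T.SuppIn D (u i)) :
    T.SuppIn D A := fun s t hst => by
  have h1 := hA.mapL (entryCLM s t)
  simp only [entryCLM_apply, h _ s t hst] at h1
  exact h1.unique hasSum_zero

theorem sum {ι : Type*} {u : ι → BddOp V} (I : Finset ι) (h : ∀ i ∈ I, T.SuppIn D (u i)) :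
    T.SuppIn D (∑ i ∈ I, u i) := fun s t hst => by
  rw [← entryCLM_apply, map_sum]
  exact Finset.sum_eq_zero fun i hi => by rw [entryCLM_apply, h i hi s t hst]

theorem one (h : 0 ∈ D) : T.SuppIn D (1 : BddOp V) := fun s t hst => by
  have : s ≠ t := by rintro rfl; exact hst (by simpa using h)
  simp [chi_apply, this]

theorem pow (hA : T.SuppIn {-1} A) (n : ℕ) : T.SuppIn {-(n : ℤ)} (A ^ n) := by
  induction n with
  | zero => exact one (by simp)
  | succ n ih =>
    rw [pow_succ]
    refine ih.mul hA ?_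
    rintro _ rfl _ rfl
    simp only [Set.mem_singleton_iff]
    push_cast
    ring

end SuppIn

theorem mem_causal_iff (S : BddOp V) : S ∈ T.causal ↔ T.SuppIn (Set.Ici 0) S := by
  constructor
  · intro h s t hst
    -- Causality is tested on `χ_t` at `s` itself: `t` lies on a strictly higher level than `s`, so
    -- `χ_t` vanishes at every node that precedes `s`.
    refine h s (chi t) (fun u hu => ?_) s ((T.precedes_iff s s).2 le_rfl)
    rw [chi_apply, if_neg]
    rintro rfl
    rw [precedes_iff] at hu
    simp only [Set.mem_Ici, sub_nonneg] at hst
    exact hst hu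
  · intro h s f hf t ht
    refine h.apply_eq_zero fun u hu => hf u ?_
    rw [precedes_iff] at ht ⊢
    simp only [Set.mem_Ici, sub_nonneg] at hu
    exact hu.trans ht

/-- The adjoint transposes entries and so negates the index of a diagonal; causality of both
operators leaves only index `0`. -/
theorem mem_const_iff (S : BddOp V) : S ∈ T.const ↔ T.SuppIn {0} S := by
  constructor
  · rintro ⟨h1, h2⟩ s t hst
    rw [mem_causal_iff] at h1 h2
    by_cases h : T.level s - T.level t ∈ Set.Ici (0 : ℤ)
    · have := h2 t s (by
        simp only [Set.mem_Ici, Set.mem_singleton_iff] at h hst ⊢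
        omega)
      rwa [star_entry, star_eq_zero] at this
    · exact h1 s t h
  · intro h
    refine ⟨(T.mem_causal_iff _).2 (h.mono (by simp)), (T.mem_causal_iff _).2 (h.star ?_)⟩
    rintro _ rfl
    simp

theorem star_mem_const {c : BddOp V} (hc : c ∈ T.const) : star c ∈ T.const :=
  ⟨hc.2, by rw [star_star]; exact hc.1⟩

theorem suppIn_shiftOp (j : Fin q) : T.SuppIn {-1} (T.shiftOp j) := fun s t hst => by
  rw [shiftOp_apply, chi_apply, if_neg]
  rintro rfl
  rw [level_shift] at hst
  simp at hst

theorem suppIn_rowShift {c : Fin q → BddOp V} (hc : ∀ j, c j ∈ T.const) :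
    T.SuppIn {-1} (T.rowShift c) := by
  refine SuppIn.sum _ fun j _ => ((T.mem_const_iff _).1 (hc j)).mul (T.suppIn_shiftOp j) ?_
  rintro _ rfl _ rfl
  simp

open Classical in
-- By `act_bijective` the node `s` is `uw` for exactly one `u` and one word `w` of length `n`, so a
-- single word contributes to the row of `s`. Its condition `t ≍ u` says exactly that the levels of
-- `s` and `t` differ by `n`.
theorem homPart_entry (S : BddOp V) (n : ℕ) (s t : V) :
    T.homPart S n (chi t) s = if T.level s - T.level t = n then S (chi t) s else 0 := by
  obtain ⟨⟨w, u⟩, rfl⟩ := (T.act_bijective n).2 s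
  simp only [homPart, _root_.sum_apply, lp.coeFn_sum, Finset.sum_apply, mul_apply_eq_comp,
    star_wordOp_apply, coeff_apply, asymp_iff, level_act, List.length_ofFn]
  rw [Finset.sum_ite_eq' Finset.univ w, if_pos (Finset.mem_univ _)]
  have : T.level t = T.level u ↔ T.level u + n - T.level t = n := by omega
  simp only [this]

/-! ### The Neumann series of `cα` and the point evaluation -/

theorem kernelOp_mul {c : Fin q → BddOp V} (hc : c ∈ T.ball) :
    T.kernelOp c * (1 - star (T.rowShift c)) = 1 := Ring.inverse_mul_cancel _ (T.isUnit_one_sub hc)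

/-- The norm of `cα` may exceed one, but the root condition makes the Neumann series converge
absolutely. Its sum is a left inverse of `1 - cα` and the adjoint kernel is a right inverse, so the
two agree. -/
theorem hasSum_star_kernelOp {c : Fin q → BddOp V} (hc : c ∈ T.ball) :
    HasSum (fun n : ℕ => T.rowShift c ^ n) (star (T.kernelOp c)) := by
  have hs := (T.summable_norm_rowShift_pow hc).of_norm
  have h1 : (1 - T.rowShift c) * star (T.kernelOp c) = 1 := by
    have := congrArg star (T.kernelOp_mul hc)
    simpa using this
  have h2 : (∑' n : ℕ, T.rowShift c ^ n) * (1 - T.rowShift c) = 1 := by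
    refine tendsto_nhds_unique
      (((hs.hasSum.tendsto_sum_nat).mul_const (1 - T.rowShift c))) ?_
    simp_rw [geom_sum_mul_neg]
    simpa using hs.tendsto_atTop_zero.const_sub 1
  have h3 : ∑' n : ℕ, T.rowShift c ^ n = star (T.kernelOp c) := left_inv_eq_right_inv h2 h1
  exact h3 ▸ hs.hasSum

theorem suppIn_star_kernelOp {c : Fin q → BddOp V} (hc : c ∈ T.ball) :
    T.SuppIn (Set.Iic 0) (star (T.kernelOp c)) :=
  SuppIn.of_hasSum (T.hasSum_star_kernelOp hc) fun n =>
    ((T.suppIn_rowShift hc.1).pow n).mono (by simp)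

theorem kernelOp_mem_causal {c : Fin q → BddOp V} (hc : c ∈ T.ball) :
    T.kernelOp c ∈ T.causal := by
  rw [mem_causal_iff, ← star_star (T.kernelOp c)]
  exact (T.suppIn_star_kernelOp hc).star (by simp)

theorem hasSum_pointEval (S : BddOp V) {c : Fin q → BddOp V} (hc : c ∈ T.ball) :
    HasSum (fun n : ℕ => T.rowShift c ^ n * T.homPart S n) (T.pointEval S c) :=
  (T.summable_norm_pointEval S hc).of_norm.hasSum

theorem suppIn_homPart (S : BddOp V) (n : ℕ) : T.SuppIn {(n : ℤ)} (T.homPart S n) :=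
  fun s t hst => by
    rw [homPart_entry]
    exact if_neg hst

theorem suppIn_sub_homPart (S : BddOp V) (n : ℕ) :
    T.SuppIn {(n : ℤ)}ᶜ (S - T.homPart S n) := fun s t hst => by
  have h : T.level s - T.level t = n := by simpa using hst
  change S (chi t) s - T.homPart S n (chi t) s = 0
  rw [homPart_entry, if_pos h, sub_self]

theorem pointEval_mem_const (S : BddOp V) {c : Fin q → BddOp V} (hc : c ∈ T.ball) :
    T.pointEval S c ∈ T.const := by
  rw [mem_const_iff]
  refine SuppIn.of_hasSum (T.hasSum_pointEval S hc) fun n =>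
    ((T.suppIn_rowShift hc.1).pow n).mul (T.suppIn_homPart S n) ?_
  rintro _ rfl _ rfl
  simp

/-- The point evaluation `E = S^∧(c)` is characterized by the property that `(I - cα)⁻¹ (S - E)`
is strictly causal. -/
theorem suppIn_sub_pointEval {S : BddOp V} (hS : S ∈ T.causal) {c : Fin q → BddOp V}
    (hc : c ∈ T.ball) :
    T.SuppIn (Set.Ioi 0) (star (T.kernelOp c) * (S - T.pointEval S c)) := by
  intro s t hst
  have hA := T.suppIn_rowShift hc.1
  set A := T.rowShift c
  -- It remains to treat the diagonals of index `-m ≤ 0`.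
  obtain ⟨m, hm⟩ : ∃ m : ℕ, T.level s - T.level t = -m := by
    simp only [Set.mem_Ioi, not_lt] at hst
    exact ⟨(T.level t - T.level s).toNat, by omega⟩
  have hR := T.hasSum_star_kernelOp hc
  have h1 : HasSum (fun n => (A ^ n * S) (chi t) s) ((star (T.kernelOp c) * S) (chi t) s) := by
    simpa only [entryCLM_apply] using (hR.mul_right S).mapL (entryCLM s t)
  -- The terms with `n < m` vanish, since `(cα)ⁿ S` has only diagonals of index `≥ -n`; the series
  -- may therefore start at `m`.
  have h2 : HasSum (fun n => (A ^ (n + m) * S) (chi t) s)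
      ((star (T.kernelOp c) * S) (chi t) s) := by
    refine (hasSum_nat_add_iff m (f := fun n => (A ^ n * S) (chi t) s)).2 ?_
    rw [Finset.sum_eq_zero, add_zero]
    · exact h1
    · intro n hn
      have := ((hA.pow n).mul ((T.mem_causal_iff S).1 hS) (F := Set.Ici (-(n : ℤ))) (by
        rintro _ rfl e he
        simp only [Set.mem_Ici] at he ⊢
        omega)) s t
      refine this ?_
      simp only [Finset.mem_range, Set.mem_Ici] at hn ⊢
      omega
  have hE := (T.mem_const_iff _).1 (T.pointEval_mem_const S hc)
  -- The point evaluation sits on diagonal `0`, so only the term `n = m` of the Neumann series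
  -- reaches diagonal `-m`.
  have h3 : (star (T.kernelOp c) * T.pointEval S c) (chi t) s =
      (A ^ m * T.pointEval S c) (chi t) s := by
    have h := (hR.mul_right (T.pointEval S c)).mapL (entryCLM s t)
    simp only [entryCLM_apply] at h
    refine h.unique (hasSum_single m fun n hn => ?_)
    refine ((hA.pow n).mul hE (F := {-(n : ℤ)}) (by rintro _ rfl _ rfl; simp)) s t ?_
    simp only [Set.mem_singleton_iff]
    omega
  have h4 : HasSum (fun n => (A ^ m * (A ^ n * T.homPart S n)) (chi t) s)
      ((A ^ m * T.pointEval S c) (chi t) s) := by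
    simpa only [entryCLM_apply] using
      ((T.hasSum_pointEval S hc).mul_left (A ^ m)).mapL (entryCLM s t)
  -- On diagonal `-m`, the factor `(cα)ⁿ⁺ᵐ` meets only the `n`-th diagonal of `S`, which is `homPart
  -- S n`. Summing over `n` thus produces `(cα)ᵐ` times the point evaluation.
  have h5 (n : ℕ) : (A ^ (n + m) * S) (chi t) s =
      (A ^ m * (A ^ n * T.homPart S n)) (chi t) s := by
    have h := (hA.pow (n + m)).mul (T.suppIn_sub_homPart S n) (F := {-(m : ℤ)}ᶜ) (by
      rintro _ rfl e he
      simp only [Set.mem_compl_iff, Set.mem_singleton_iff] at he ⊢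
      push_cast
      omega)
    have h := h s t (by simpa using hm)
    rw [← mul_assoc, ← pow_add, Nat.add_comm m n, ← sub_eq_zero]
    rw [mul_sub] at h
    exact h
  simp only [h5] at h2
  have h6 := h2.unique h4
  rw [mul_sub]
  exact sub_eq_zero.2 (h6.trans h3.symm)

/-- On diagonal `0`, strict causality lets `S` be replaced by its point evaluation under `(I -
cα)⁻¹`; as the latter is diagonal, only the term `n = 0` of the Neumann series survives. -/
theorem pointEval_entry {S : BddOp V} (hS : S ∈ T.causal) {c : Fin q → BddOp V}
    (hc : c ∈ T.ball) {s t : V} (hst : T.level s = T.level t) :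
    T.pointEval S c (chi t) s = (star (T.kernelOp c) * S) (chi t) s := by
  have h1 := T.suppIn_sub_pointEval hS hc s t (by simp [hst])
  rw [mul_sub] at h1
  have h1 : (star (T.kernelOp c) * S) (chi t) s =
    (star (T.kernelOp c) * T.pointEval S c) (chi t) s := sub_eq_zero.1 h1
  have hE := (T.mem_const_iff _).1 (T.pointEval_mem_const S hc)
  rw [h1]
  have h := ((T.hasSum_star_kernelOp hc).mul_right (T.pointEval S c)).mapL (entryCLM s t)
  simp only [entryCLM_apply] at h
  refine HasSum.unique ?_ h
  have h0 := hasSum_single (f := fun n : ℕ => (T.rowShift c ^ n * T.pointEval S c) (chi t) s) 0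
    fun n hn => by
      refine (((T.suppIn_rowShift hc.1).pow n).mul hE (F := {-(n : ℤ)})
        (by rintro _ rfl _ rfl; simp)) s t ?_
      simp only [Set.mem_singleton_iff]
      omega
  simpa using h0

/-! ### Reproducing kernels of `𝐇₂(𝒯)` -/

theorem summable_sq_pointEval {F : BddOp V} (hF : F ∈ T.causal)
    (hs : Summable fun t => ‖F (chi t)‖ ^ 2) {c : Fin q → BddOp V} (hc : c ∈ T.ball) :
    Summable fun t => ‖T.pointEval F c (chi t)‖ ^ 2 := by
  refine Summable.of_nonneg_of_le (fun _ => by positivity) (fun t => ?_)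
    (summable_sq_comp (star (T.kernelOp c)) F hs)
  gcongr
  -- The column of `F^∧(c)` at `t` is the restriction of the column of `(I - cα)⁻¹ F` to the
  -- horocycle of `t`, so it is dominated entrywise.
  refine norm_le_of_entry_le fun s => ?_
  by_cases hst : T.level s = T.level t
  · rw [T.pointEval_entry hF hc hst]
  · rw [(T.mem_const_iff _).1 (T.pointEval_mem_const F hc) s t (by
      simpa [sub_eq_zero] using hst)]
    simp

/-- The point evaluation of an element of `𝐇₂(𝒯)` as an element of `𝐇₂(𝒯)`. -/
noncomputable def evalH2 (F : T.H2) {c : Fin q → BddOp V} (hc : c ∈ T.ball) : T.H2 :=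
  H2.ofOp (T.pointEval (H2.op T F) c) (T.pointEval_mem_const _ hc).1
    (T.summable_sq_pointEval (H2.causal_op F) (H2.summable_op F) hc)

theorem evalH2_mem_const (F : T.H2) {c : Fin q → BddOp V} (hc : c ∈ T.ball) :
    T.evalH2 F hc ∈ H2.const T := T.pointEval_mem_const _ hc

/-- The element `(I - α* c*)⁻¹ k` of `𝐇₂(𝒯)`. -/
noncomputable def kernelH2 {c : Fin q → BddOp V} (hc : c ∈ T.ball) (k : T.H2) : T.H2 :=
  T.mulLeft ⟨T.kernelOp c, T.kernelOp_mem_causal hc⟩ k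

theorem inner_kernelH2_eq_tsum {c : Fin q → BddOp V} (hc : c ∈ T.ball) (k F : T.H2) :
    inner ℂ (T.kernelH2 hc k) F =
      ∑' t, inner ℂ (H2.op T k (chi t)) ((star (T.kernelOp c) * H2.op T F) (chi t)) := by
  rw [H2.inner_def]
  refine tsum_congr fun t => ?_
  rw [ContinuousLinearMap.star_eq_adjoint]
  exact (ContinuousLinearMap.adjoint_inner_right (T.kernelOp c) _ _).symm

/-- The vector `k χ_t` is supported on the horocycle of `t`, so only the zeroth diagonals of `A` and
`B` enter. -/
theorem inner_const_congr {k : BddOp V} (hk : k ∈ T.const) {A B : BddOp V}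
    (h : T.SuppIn {0}ᶜ (A - B)) (t : V) :
    (inner ℂ (k (chi t)) (A (chi t)) : ℂ) = inner ℂ (k (chi t)) (B (chi t)) := by
  refine inner_congr_right fun s hs => sub_eq_zero.1 (h s t ?_)
  by_contra hst
  exact hs ((T.mem_const_iff k).1 hk s t fun h => hst (by simpa using h))

/-- The reproducing property of the kernels of `𝐇₂(𝒯)`. -/
theorem inner_kernelH2 {c : Fin q → BddOp V} (hc : c ∈ T.ball) {k : T.H2}
    (hk : k ∈ H2.const T) (F : T.H2) :
    inner ℂ (T.kernelH2 hc k) F = (inner ℂ k (T.evalH2 F hc) : ℂ) := by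
  rw [inner_kernelH2_eq_tsum, H2.inner_def]
  refine tsum_congr fun t => T.inner_const_congr hk ?_ t
  intro s t hst
  have hst : T.level s = T.level t := by simpa [sub_eq_zero] using hst
  exact sub_eq_zero.2 (T.pointEval_entry (H2.causal_op F) hc hst).symm

/-- The adjoint of `M_S` acts on kernels as left multiplication by `S^∧(c)*`. -/
theorem adjoint_mulLeft_kernelH2 (S : T.causal) {c : Fin q → BddOp V} (hc : c ∈ T.ball)
    {k : T.H2} (hk : k ∈ H2.const T) :
    star (T.mulLeft S) (T.kernelH2 hc k) =
      T.mulLeft ⟨star (T.pointEval (S : BddOp V) c), (T.pointEval_mem_const _ hc).2⟩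
        (T.kernelH2 hc k) := by
  refine ext_inner_right ℂ fun F => ?_
  rw [ContinuousLinearMap.star_eq_adjoint, ContinuousLinearMap.adjoint_inner_left]
  set E : T.causal := ⟨T.pointEval (S : BddOp V) c, (T.pointEval_mem_const _ hc).1⟩ with hE
  have h1 : inner ℂ (T.mulLeft ⟨star (T.pointEval (S : BddOp V) c),
      (T.pointEval_mem_const _ hc).2⟩ (T.kernelH2 hc k)) F =
      (inner ℂ (T.kernelH2 hc k) (T.mulLeft E F) : ℂ) := by
    rw [H2.inner_def, H2.inner_def]
    refine tsum_congr fun t => ?_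
    exact ContinuousLinearMap.adjoint_inner_left (E : BddOp V) _ _
  rw [h1, inner_kernelH2_eq_tsum, inner_kernelH2_eq_tsum]
  refine tsum_congr fun t => T.inner_const_congr hk ?_ t
  -- A strictly causal operator times the causal `F` has no zeroth diagonal, so `S` may be replaced
  -- by `E` in the pairing with `k`.
  have := (T.suppIn_sub_pointEval S.2 hc).mul ((T.mem_causal_iff _).1 (H2.causal_op F))
    (F := {0}ᶜ) (by
      intro d hd e he
      simp only [Set.mem_Ioi, Set.mem_Ici, Set.mem_compl_iff, Set.mem_singleton_iff] at *
      omega)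
  rw [op_mulLeft, op_mulLeft, ← mul_assoc, ← mul_assoc, ← sub_mul, ← mul_sub]
  exact this

end HomogeneousTree

/-! ### Hilbert–Schmidt operators by columns and by rows -/

section HilbertSchmidt

variable {V : Type*}

theorem norm_sq_eq_tsum (f : Ell2 V) : ‖f‖ ^ 2 = ∑' s, ‖f s‖ ^ 2 := by
  have := lp.norm_rpow_eq_tsum (p := 2) (by norm_num) f
  simpa using this

theorem summable_norm_sq (f : Ell2 V) : Summable fun s => ‖f s‖ ^ 2 := by
  have := (lp.memℓp f).summable (by norm_num)
  simpa using this

/-- This is Tonelli's theorem; the entrywise form is symmetric under transposition, which yields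
`summable_columns_star`. -/
theorem summable_columns_iff (A : BddOp V) : (Summable fun t => ‖A (chi t)‖ ^ 2) ↔
    Summable fun x : V × V => ‖A (chi x.1) x.2‖ ^ 2 := by
  rw [summable_prod_of_nonneg (fun _ => by positivity)]
  simp only [← norm_sq_eq_tsum, summable_norm_sq, implies_true, true_and]

theorem summable_columns_star {A : BddOp V} (hA : Summable fun t => ‖A (chi t)‖ ^ 2) :
    Summable fun t => ‖(star A) (chi t)‖ ^ 2 := by
  rw [summable_columns_iff] at hA ⊢
  simpa [star_entry, Function.comp_def] using (Equiv.prodComm V V).summable_iff.2 hA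

/-- The trace formula `trace(A* B) = trace(B A*)`. -/
theorem tsum_inner_columns {A B : BddOp V} (hA : Summable fun t => ‖A (chi t)‖ ^ 2)
    (hB : Summable fun t => ‖B (chi t)‖ ^ 2) :
    ∑' t, inner ℂ (A (chi t)) (B (chi t)) =
      (∑' s, inner ℂ ((star B) (chi s)) ((star A) (chi s)) : ℂ) := by
  rw [summable_columns_iff] at hA hB
  have hs : Summable (Function.uncurry fun t s => (inner ℂ (A (chi t) s) (B (chi t) s) : ℂ)) := by
    refine Summable.of_norm_bounded (hA.add hB) fun x => ?_
    refine (norm_inner_le_norm _ _).trans ?_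
    change ‖A (chi x.1) x.2‖ * ‖B (chi x.1) x.2‖ ≤ _
    nlinarith [sq_nonneg (‖A (chi x.1) x.2‖ - ‖B (chi x.1) x.2‖),
      sq_nonneg ‖A (chi x.1) x.2‖, sq_nonneg ‖B (chi x.1) x.2‖]
  simp only [lp.inner_eq_tsum]
  rw [← hs.tsum_comm]
  refine tsum_congr fun s => tsum_congr fun t => ?_
  rw [star_entry, star_entry]
  simp [mul_comm]

end HilbertSchmidt

/-! ### Right multiplication on `𝐇₂(𝒯)` -/

namespace HomogeneousTree

variable {q : ℕ} {V : Type*} {T : HomogeneousTree q V}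

theorem summable_columns_mul_right (F c : BddOp V) (h : Summable fun t => ‖F (chi t)‖ ^ 2) :
    Summable fun t => ‖(F * c) (chi t)‖ ^ 2 := by
  have := summable_columns_star (summable_sq_comp (star c) (star F) (summable_columns_star h))
  simpa using this

namespace H2

/-- In this form `F ↦ F c` becomes left multiplication of `F*` by `c*`, so its norm bound and its
adjoint follow column by column. -/
theorem inner_eq_rows (F G : T.H2) : inner ℂ F G =
    (∑' s, inner ℂ ((star (op T G)) (chi s)) ((star (op T F)) (chi s)) : ℂ) :=
  tsum_inner_columns (summable_op F) (summable_op G)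

theorem norm_sq_eq_rows (F : T.H2) : ‖F‖ ^ 2 = ∑' s, ‖(star (op T F)) (chi s)‖ ^ 2 := by
  have h := inner_eq_rows F F
  simp only [inner_self_eq_norm_sq_to_K, Complex.coe_algebraMap] at h
  exact_mod_cast h

variable (T) in
/-- The product `F c` as an element of `𝐇₂(𝒯)`. -/
noncomputable def mulRightFun (c : T.causal) (F : T.H2) : T.H2 :=
  ofOp (op T F * c) (T.causal.mul_mem (causal_op F) c.2)
    (summable_columns_mul_right _ _ (summable_op F))

theorem norm_mulRightFun_le (c : T.causal) (F : T.H2) :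
    ‖mulRightFun T c F‖ ≤ ‖(c : BddOp V)‖ * ‖F‖ := by
  have h1 := norm_sq_eq_rows (mulRightFun T c F)
  have h0 := summable_columns_star (summable_op F)
  have h2 : op T (mulRightFun T c F) = op T F * c := rfl
  rw [h2, star_mul] at h1
  have h4 (t : V) : ‖(star (c : BddOp V) * star (op T F)) (chi t)‖ ^ 2 ≤
      ‖(c : BddOp V)‖ ^ 2 * ‖(star (op T F)) (chi t)‖ ^ 2 := by
    rw [← mul_pow, ← norm_star (c : BddOp V)]
    exact pow_le_pow_left₀ (norm_nonneg _) ((star (c : BddOp V)).le_opNorm _) 2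
  have h5 := (summable_sq_comp _ _ h0).tsum_le_tsum h4 (h0.mul_left _)
  rw [← h1, tsum_mul_left, ← norm_sq_eq_rows, ← mul_pow] at h5
  exact (sq_le_sq₀ (norm_nonneg _) (by positivity)).1 h5

variable (T) in
/-- The right multiplication operator `F ↦ F c` on `𝐇₂(𝒯)`. -/
noncomputable def mulRight (c : T.causal) : T.H2 →L[ℂ] T.H2 :=
  LinearMap.mkContinuous
    { toFun := mulRightFun T c
      map_add' := fun F G => op_injective (by
        change op T (F + G) * (c : BddOp V) = op T F * c + op T G * c
        rw [map_add, add_mul])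
      map_smul' := fun a F => op_injective (by
        change op T (a • F) * (c : BddOp V) = a • (op T F * c)
        rw [map_smul, smul_mul_assoc]) }
    ‖(c : BddOp V)‖ (norm_mulRightFun_le c)

theorem op_mulRight (c : T.causal) (F : T.H2) : op T (mulRight T c F) = op T F * c := rfl

theorem norm_mulRight_apply_le (c : T.causal) (F : T.H2) :
    ‖mulRight T c F‖ ≤ ‖(c : BddOp V)‖ * ‖F‖ := norm_mulRightFun_le c F

theorem inner_mulRight_left {c d : T.causal} (h : star (c : BddOp V) = d) (F G : T.H2) :
    (inner ℂ (mulRight T c F) G : ℂ) = inner ℂ F (mulRight T d G) := by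
  rw [inner_eq_rows, inner_eq_rows]
  refine tsum_congr fun s => ?_
  rw [op_mulRight, op_mulRight, star_mul, star_mul, ← h, star_star]
  exact ContinuousLinearMap.adjoint_inner_right (c : BddOp V) _ _

theorem star_mulRight {c : BddOp V} (hc : c ∈ T.const) :
    star (mulRight T ⟨c, hc.1⟩) = mulRight T ⟨star c, hc.2⟩ := by
  refine ContinuousLinearMap.ext fun F => ext_inner_left ℂ fun G => ?_
  rw [ContinuousLinearMap.star_eq_adjoint, ContinuousLinearMap.adjoint_inner_right]
  exact inner_mulRight_left rfl G F

theorem commute_mulRight_mulLeft (c S : T.causal) :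
    Commute (mulRight T c) (T.mulLeft S) := by
  refine ContinuousLinearMap.ext fun F => op_injective ?_
  exact mul_assoc (S : BddOp V) (op T F) c

end H2

/-! ### Right invariance and completeness of `𝐇(S)` -/

namespace SchurMultiplier

variable (S : T.SchurMultiplier)

/-- Commutation with `M_S` is associativity. Commutation with `M_S*` is the adjoint of the same
relation for `c*`, which is causal because `c` is a constant. -/
theorem commute_mulRight_defect {c : BddOp V} (hc : c ∈ T.const) :
    Commute (H2.mulRight T ⟨c, hc.1⟩) S.defect := by
  refine (Commute.one_right _).sub_right ((H2.commute_mulRight_mulLeft _ _).mul_right ?_)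
  have h : Commute (H2.mulRight T ⟨star c, hc.2⟩) S.mul := H2.commute_mulRight_mulLeft _ _
  rw [← H2.star_mulRight hc] at h
  have h' := h.star_star
  rwa [star_star] at h'

theorem commute_mulRight_sqrtDefect {c : BddOp V} (hc : c ∈ T.const) :
    Commute (H2.mulRight T ⟨c, hc.1⟩) S.sqrtDefect :=
  ((S.commute_mulRight_defect hc).symm.cfcₙ_nnreal NNReal.sqrt).symm

/-- The kernel of `ℬ_S` is invariant under right multiplication by `c` and by `c*`, so it reduces
this operator. -/
theorem commute_mulRight_kerProj {c : BddOp V} (hc : c ∈ T.const) :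
    Commute (H2.mulRight T ⟨c, hc.1⟩) S.kerProj := by
  have hmem {d : BddOp V} (hd : d ∈ T.const) {F : T.H2} (hF : F ∈ S.defect.ker) :
      H2.mulRight T ⟨d, hd.1⟩ F ∈ S.defect.ker := by
    have h := congrArg (fun A => A F) (S.commute_mulRight_defect hd).eq
    rw [LinearMap.mem_ker] at hF ⊢
    refine h.symm.trans ?_
    exact (congrArg (H2.mulRight T ⟨d, hd.1⟩) hF).trans (map_zero _)
  refine ContinuousLinearMap.ext fun F => ?_
  refine (Submodule.eq_starProjection_of_mem_of_inner_eq_zero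
    (hmem hc (Submodule.starProjection_apply_mem _ F)) fun G hG => ?_).symm
  -- Orthogonality of `(F - π_S F) c` to the kernel: move `c` to the other side as `c*`, under which
  -- the kernel is stable.
  have h := Submodule.starProjection_inner_eq_zero F _ (hmem (T.star_mem_const hc) hG)
  rw [← H2.inner_mulRight_left (c := ⟨c, hc.1⟩) rfl, map_sub] at h
  exact h

theorem compl_kerProj_mulRight {c : BddOp V} (hc : c ∈ T.const) (F : T.H2) :
    (1 - S.kerProj) (H2.mulRight T ⟨c, hc.1⟩ F) =
      H2.mulRight T ⟨c, hc.1⟩ ((1 - S.kerProj) F) :=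
  congrArg (fun A => A F)
    ((Commute.one_right _).sub_right (S.commute_mulRight_kerProj hc)).eq.symm

namespace DBR

theorem incl_ofH2_mulRight {c : BddOp V} (hc : c ∈ T.const) (F : T.H2) :
    incl S (ofH2 S (H2.mulRight T ⟨c, hc.1⟩ F)) =
      H2.mulRight T ⟨c, hc.1⟩ (incl S (ofH2 S F)) :=
  congrArg (fun A => A F) (S.commute_mulRight_sqrtDefect hc).eq.symm

theorem rightConstInvariant : T.RightConstInvariant (incl S) := by
  refine ⟨incl_injective, fun c hc F G => ?_⟩
  obtain ⟨F, rfl⟩ := exists_eq_ofH2 F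
  obtain ⟨G, rfl⟩ := exists_eq_ofH2 G
  have hc' := T.star_mem_const hc
  refine ⟨ofH2 S (H2.mulRight T ⟨c, hc.1⟩ F), ofH2 S (H2.mulRight T ⟨star c, hc'.1⟩ G),
    ?_, ?_, ?_, ?_⟩
  · rw [incl_ofH2_mulRight S hc, H2.op_mulRight]
  · rw [incl_ofH2_mulRight S hc', H2.op_mulRight]
  · rw [norm_ofH2, norm_ofH2, compl_kerProj_mulRight S hc, mul_comm]
    exact H2.norm_mulRight_apply_le _ _
  · rw [inner_ofH2, inner_ofH2, compl_kerProj_mulRight S hc, compl_kerProj_mulRight S hc']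
    exact H2.inner_mulRight_left rfl _ _

theorem isometry_lift : Isometry (lift (S := S)) :=
  AddMonoidHomClass.isometry_of_norm _ fun _ => rfl

/-- The image is the range of `I - π_S`; being closed, it transfers completeness to `𝐇(S)` through
`isometry_lift`. -/
theorem range_lift : (lift (S := S)).range = S.defect.kerᗮ := by
  ext F
  have h0 (G : T.H2) : (1 - S.kerProj) G = S.defect.kerᗮ.starProjection G := by
    rw [Submodule.starProjection_orthogonal']; rfl
  constructor
  · rintro ⟨G, rfl⟩
    obtain ⟨G, rfl⟩ := exists_eq_ofH2 G
    rw [lift_ofH2, h0]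
    exact Submodule.starProjection_apply_mem _ _
  · intro hF
    refine ⟨ofH2 S F, ?_⟩
    rw [lift_ofH2, h0, Submodule.starProjection_eq_self_iff.2 hF]

instance : CompleteSpace S.DBR := by
  rw [completeSpace_iff_isComplete_range (isometry_lift S).isUniformInducing]
  have h : Set.range (lift (S := S)) = (S.defect.kerᗮ : Set T.H2) :=
    congrArg SetLike.coe (range_lift S)
  rw [h]
  exact (Submodule.isClosed_orthogonal _).isComplete

end DBR

end SchurMultiplier

end HomogeneousTree

/-! ### Reproducing kernels of `𝐇(S)` -/

namespace HomogeneousTree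

variable {q : ℕ} {V : Type*} (T : HomogeneousTree q V)

namespace SchurMultiplier

variable {T} (S : T.SchurMultiplier)

theorem inner_sqrtDefect_left (F G : T.H2) :
    (inner ℂ (S.sqrtDefect F) G : ℂ) = inner ℂ F (S.sqrtDefect G) := by
  have hsa : star S.sqrtDefect = S.sqrtDefect :=
    (IsSelfAdjoint.of_nonneg (CFC.sqrt_nonneg S.defect)).star_eq
  nth_rw 1 [← hsa]
  rw [ContinuousLinearMap.star_eq_adjoint, ContinuousLinearMap.adjoint_inner_left]

theorem sqrtDefect_kerProj (F : T.H2) : S.sqrtDefect (S.kerProj F) = 0 :=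
  (S.sqrtDefect_eq_zero_iff _).2 (Submodule.starProjection_apply_mem S.defect.ker F)

theorem kerProj_sqrtDefect (F : T.H2) : S.kerProj (S.sqrtDefect F) = 0 := by
  refine (Submodule.starProjection_apply_eq_zero_iff _).2 fun G hG => ?_
  rw [← inner_sqrtDefect_left, (S.sqrtDefect_eq_zero_iff G).2 hG, inner_zero_left]

namespace DBR

/-- The projections drop out because `√ℬ_S` maps into `(ker ℬ_S)ᗮ` and annihilates `ker ℬ_S`;
self-adjointness of `√ℬ_S` does the rest. This carries kernels of `𝐇₂(𝒯)` to kernels of `𝐇(S)`. -/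
theorem inner_ofH2_sqrtDefect (F : T.H2) (G : S.DBR) :
    (inner ℂ (ofH2 S (S.sqrtDefect F)) G : ℂ) = inner ℂ F (incl S G) := by
  obtain ⟨G, rfl⟩ := exists_eq_ofH2 G
  have h1 : (1 - S.kerProj) (S.sqrtDefect F) = S.sqrtDefect F := by
    change S.sqrtDefect F - S.kerProj (S.sqrtDefect F) = _
    rw [kerProj_sqrtDefect, sub_zero]
  have h2 : S.sqrtDefect ((1 - S.kerProj) G) = S.sqrtDefect G := by
    change S.sqrtDefect (G - S.kerProj G) = _
    rw [map_sub, sqrtDefect_kerProj, sub_zero]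
  rw [inner_ofH2, h1, inner_sqrtDefect_left, h2, incl_ofH2]

/-- The element `K_S^c k` of `𝐇(S)`. -/
noncomputable def kernel {c : Fin q → BddOp V} (hc : c ∈ T.ball) (k : T.H2) : S.DBR :=
  ofH2 S (S.sqrtDefect (T.kernelH2 hc k))

theorem op_incl_kernel {c : Fin q → BddOp V} (hc : c ∈ T.ball) {k : T.H2}
    (hk : k ∈ H2.const T) :
    H2.op T (incl S (kernel S hc k)) = T.schurKernelOp S.op c * H2.op T k := by
  have h1 : incl S (kernel S hc k) =
      T.kernelH2 hc k - S.mul (star S.mul (T.kernelH2 hc k)) :=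
    congrArg (fun A => A (T.kernelH2 hc k)) S.sqrtDefect_mul_self
  have h2 : star S.mul (T.kernelH2 hc k) = _ :=
    T.adjoint_mulLeft_kernelH2 ⟨S.op, S.causal⟩ hc hk
  rw [h1, h2, map_sub]
  change T.kernelOp c * H2.op T k -
    S.op * (star (T.pointEval S.op c) * (T.kernelOp c * H2.op T k)) = _
  rw [schurKernelOp]
  noncomm_ring

theorem inner_kernel {c : Fin q → BddOp V} (hc : c ∈ T.ball) {k : T.H2}
    (hk : k ∈ H2.const T) (F : S.DBR) :
    (inner ℂ (kernel S hc k) F : ℂ) = inner ℂ k (T.evalH2 (incl S F) hc) := by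
  rw [kernel, inner_ofH2_sqrtDefect, inner_kernelH2 T hc hk]

end DBR

end SchurMultiplier

/-! ### Nilpotent shifts along finite paths -/

section Paths

open Classical in
theorem exists_indicatorOp (U : Set V) :
    ∃ P : BddOp V, ∀ f t, P f t = if t ∈ U then f t else 0 := by
  refine ⟨opOfBound ⟨⟨fun f t => if t ∈ U then f t else 0, ?_⟩, ?_⟩ 1 ?_, fun f t => rfl⟩
  · intro f g; ext t; by_cases hh : t ∈ U <;> simp [hh]
  · intro c f; ext t; by_cases hh : t ∈ U <;> simp [hh]
  · intro f
    rw [ENNReal.coe_one, one_mul, enorm_sq_eq_tsum f]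
    refine ENNReal.tsum_le_tsum fun t => ?_
    by_cases hh : t ∈ U <;> simp [hh]

/-- Multiplication by the indicator function of a set of nodes. -/
noncomputable def indicatorOp (U : Set V) : BddOp V := (exists_indicatorOp U).choose

open Classical in
theorem indicatorOp_apply (U : Set V) (f : Ell2 V) (t : V) :
    indicatorOp U f t = if t ∈ U then f t else 0 := (exists_indicatorOp U).choose_spec f t

theorem indicatorOp_mem_const (U : Set V) : indicatorOp U ∈ T.const := by
  rw [mem_const_iff]
  intro s t hst
  have : s ≠ t := by rintro rfl; simp at hst
  rw [indicatorOp_apply, chi_apply, if_neg this]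
  simp

variable {T} (r : GraphRay T.graph) (n : ℕ)

/-- The row `c` of constants for which `cα` moves values along the first `n` edges of a path and
annihilates all other values. -/
noncomputable def pathRow : Fin q → BddOp V := fun j =>
  indicatorOp {u | ∃ k < n, u = r.node (k + 1) ∧ T.shift j u = r.node k}

open Classical in
theorem rowShift_pathRow_apply (f : Ell2 V) (s : V) : T.rowShift (pathRow r n) f s =
    ∑ j, if ∃ k < n, s = r.node (k + 1) ∧ T.shift j s = r.node k then f (T.shift j s) else 0 := by
  simp only [rowShift, _root_.sum_apply, lp.coeFn_sum, Finset.sum_apply, mul_apply_eq_comp,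
    pathRow, indicatorOp_apply, shiftOp_apply, Set.mem_ofPred_eq]
  exact Finset.sum_congr rfl fun j _ => by congr

theorem rowShift_pathRow_eq_zero (f : Ell2 V) {s : V} (hs : ∀ k < n, s ≠ r.node (k + 1)) :
    T.rowShift (pathRow r n) f s = 0 := by
  classical
  rw [rowShift_pathRow_apply]
  refine Finset.sum_eq_zero fun j _ => if_neg ?_
  rintro ⟨k, hk, h, -⟩
  exact hs k hk h

variable {r}

theorem drop_mem_infty (hr : ⟦r⟧ = T.infty) (n : ℕ) : ⟦r.drop n⟧ = T.infty := by
  have h : r.drop n ≈ r := ⟨0, n, fun k => by simp [GraphRay.drop]⟩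
  exact (Quotient.sound h).trans hr

theorem level_node (hr : ⟦r⟧ = T.infty) (n : ℕ) :
    T.level (r.node n) = T.level (r.node 0) - n := by
  have h := T.level_sub (drop_mem_infty hr n) hr (m := 0) (n := n)
    (fun k => by simp [GraphRay.drop])
  have h' : (r.drop n).node 0 = r.node n := rfl
  rw [h'] at h
  push_cast at h
  omega

theorem rowShift_pathRow_node (hr : ⟦r⟧ = T.infty) {k : ℕ} (hk : k < n) (f : Ell2 V) :
    T.rowShift (pathRow r n) f (r.node (k + 1)) = f (r.node k) := by
  classical
  obtain ⟨j, hj⟩ := (T.shift_eq_iff (r.drop k) (drop_mem_infty hr k) (r.node (k + 1))).2 rfl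
  have hj : T.shift j (r.node (k + 1)) = r.node k := hj
  rw [rowShift_pathRow_apply, Finset.sum_eq_single j]
  · rw [if_pos ⟨k, hk, rfl, hj⟩, hj]
  · intro i _ hij
    refine if_neg ?_
    rintro ⟨l, -, h1, h2⟩
    have hl := r.node_injective T.isTree h1
    obtain rfl : k = l := by omega
    exact hij (T.shift_injective_index _ (h2.trans hj.symm))
  · intro h; exact absurd (Finset.mem_univ j) h

/-- Each application moves the value at `r_k` to `r_{k+1}`, and nothing enters at `r_0`. -/
theorem rowShift_pathRow_pow_node (hr : ⟦r⟧ = T.infty) (f : Ell2 V) (m : ℕ) {k : ℕ} (hk : k ≤ n) :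
    (T.rowShift (pathRow r n) ^ m) f (r.node k) = if m ≤ k then f (r.node (k - m)) else 0 := by
  induction m generalizing k with
  | zero => simp
  | succ m ih =>
    rw [pow_succ', mul_apply_eq_comp]
    cases k with
    | zero =>
      rw [rowShift_pathRow_eq_zero]
      · simp
      · intro k _ h
        have := r.node_injective T.isTree h
        omega
    | succ k =>
      rw [rowShift_pathRow_node n hr (by omega), ih (by omega)]
      simp

theorem rowShift_pathRow_pow_eq_zero (hr : ⟦r⟧ = T.infty) :
    T.rowShift (pathRow r n) ^ (n + 1) = 0 := by
  refine ContinuousLinearMap.ext fun f => lp.ext (funext fun s => ?_)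
  by_cases hs : ∃ k ≤ n, s = r.node k
  · obtain ⟨k, hk, rfl⟩ := hs
    rw [rowShift_pathRow_pow_node n hr f _ hk, if_neg (by omega)]
    simp
  · rw [pow_succ', mul_apply_eq_comp, rowShift_pathRow_eq_zero]
    · simp
    · intro k hk h
      exact hs ⟨k + 1, hk, h⟩

/-- Nilpotency of `cα` makes the limit `0`, whatever its norm. -/
theorem pathRow_mem_ball (hr : ⟦r⟧ = T.infty) : pathRow r n ∈ T.ball := by
  refine ⟨fun j => T.indicatorOp_mem_const _, 0, one_pos, ?_⟩
  refine tendsto_const_nhds.congr' ?_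
  filter_upwards [eventually_ge_atTop (n + 1)] with m hm
  rw [pow_eq_zero_of_le hm (rowShift_pathRow_pow_eq_zero n hr), norm_zero, Real.zero_rpow]
  -- The exponent `1 / m` must be nonzero, since `0 ^ 0 = 1`.
  have : (0 : ℝ) < m := by exact_mod_cast (by omega : 0 < m)
  positivity

end Paths

/-- A causal operator is determined by its point evaluations. -/
theorem eq_zero_of_pointEval {F : BddOp V} (hF : F ∈ T.causal)
    (h : ∀ c ∈ T.ball, T.pointEval F c = 0) : F = 0 := by
  -- Strong induction on the level difference `n` of `r_0` and `t`. For the row `c` of the first `n`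
  -- edges, the entry of `F^∧(c)` at `(r_n, t)` is the sum over `m ≤ n` of the entries of `F` at
  -- `(r_{n-m}, t)`, where the level difference is `m`. The terms with `m < n` vanish by induction,
  -- and `m = n` is the entry sought.
  have key : ∀ (n : ℕ) (r : GraphRay T.graph), ⟦r⟧ = T.infty → ∀ t,
      T.level (r.node 0) = T.level t + n → F (chi t) (r.node 0) = 0 := by
    intro n
    induction n using Nat.strong_induction_on with
    | _ n ih =>
    intro r hr t hrt
    have hc := pathRow_mem_ball n hr
    have h0 := T.pointEval_entry hF hc (s := r.node n) (t := t) (by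
      rw [level_node hr]; omega)
    rw [h _ hc] at h0
    have h1 := ((T.hasSum_star_kernelOp hc).mul_right F).mapL (entryCLM (r.node n) t)
    simp only [entryCLM_apply, mul_apply_eq_comp, rowShift_pathRow_pow_node n hr _ _ le_rfl] at h1
    have h2 := h1.unique (hasSum_single n fun m hm => ?_)
    · rw [if_pos le_rfl, Nat.sub_self] at h2
      rw [← h2]
      exact h0.symm
    · split_ifs with hmn
      · refine ih m (by omega) (r.drop (n - m)) (drop_mem_infty hr _) t ?_
        change T.level (r.node (n - m)) = _
        rw [level_node hr]
        omega
      · rfl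
  refine op_ext_entry fun s t => ?_
  by_cases hst : T.level s - T.level t ∈ Set.Ici (0 : ℤ)
  · obtain ⟨r, hr, rfl⟩ := exists_ray T.isTree T.infty s
    refine key (T.level (r.node 0) - T.level t).toNat r hr t ?_
    simp only [Set.mem_Ici] at hst
    omega
  · exact (T.mem_causal_iff F).1 hF s t hst

end HomogeneousTree

/-! ### The de Branges–Rovnyak space of a Schur multiplier -/

theorem proposition6p4 {q : ℕ} {V : Type*} (T : HomogeneousTree q V) (S : T.SchurMultiplier) :
    -- `𝐇(S)` is a right `𝒞`-invariant Hilbert space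
    CompleteSpace S.DBR ∧
    T.RightConstInvariant (HomogeneousTree.SchurMultiplier.DBR.incl S) ∧
    -- `K_S^c k ∈ 𝐇(S)`, and `⟨F, K_S^c k⟩ = ⟨F^∧(c), k⟩₂` for all `F ∈ 𝐇(S)`
    (∀ c ∈ T.ball, ∀ k ∈ HomogeneousTree.H2.const T, ∃ G : S.DBR,
      HomogeneousTree.H2.op T (HomogeneousTree.SchurMultiplier.DBR.incl S G) =
        T.schurKernelOp S.op c * HomogeneousTree.H2.op T k ∧
      ∀ F : S.DBR, ∃ E ∈ HomogeneousTree.H2.const T,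
        HomogeneousTree.H2.op T E = T.pointEval
          (HomogeneousTree.H2.op T (HomogeneousTree.SchurMultiplier.DBR.incl S F)) c ∧
        inner ℂ G F = inner ℂ k E) ∧
    -- the elements `K_S^c k` span a dense subspace of `𝐇(S)`
    (Submodule.span ℂ {G : S.DBR | ∃ c ∈ T.ball, ∃ k ∈ HomogeneousTree.H2.const T,
      HomogeneousTree.H2.op T (HomogeneousTree.SchurMultiplier.DBR.incl S G) =
        T.schurKernelOp S.op c * HomogeneousTree.H2.op T k}).topologicalClosure = ⊤ := by
  open HomogeneousTree SchurMultiplier in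
  refine ⟨inferInstance, DBR.rightConstInvariant S, fun c hc k hk =>
    ⟨DBR.kernel S hc k, DBR.op_incl_kernel S hc hk, fun F =>
      ⟨T.evalH2 (DBR.incl S F) hc, T.evalH2_mem_const _ hc, rfl, DBR.inner_kernel S hc hk F⟩⟩, ?_⟩
  open HomogeneousTree SchurMultiplier in
  rw [Submodule.topologicalClosure_eq_top_iff, Submodule.eq_bot_iff]
  intro F hF
  rw [← map_eq_zero_iff _ DBR.incl_injective, ← map_eq_zero_iff _ H2.op_injective]
  refine T.eq_zero_of_pointEval (H2.causal_op _) fun c hc => ?_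
  -- The point evaluation of `F` is itself an admissible `k`; orthogonality of `F` to the
  -- corresponding kernel then reads `‖F^∧(c)‖₂² = 0`.
  have hk := T.evalH2_mem_const (DBR.incl S F) hc
  have h := hF _ (Submodule.subset_span ⟨c, hc, _, hk, DBR.op_incl_kernel S hc hk⟩)
  rw [DBR.inner_kernel S hc hk, inner_self_eq_zero] at h
  exact congrArg (H2.op T) h
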